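/- Let $n\ge 1$. Consider a linear network with parties $A_1,\dots,A_{n+1}$ and independent sources $\mathcal S_1,\dots,\mathcal S_n$, where $\mathcal S_i$ sends one qubit of an arbitrary two-qubit state (density matrix) $\rho_i$ to $A_i$ and the other to $A_{i+1}$, so that the overall state is $\rho_1\otimes\cdots\otimes\rho_n$. The extreme parties $A_1$ and $A_{n+1}$ each choose, by inputs $x_1,x_{n+1}\in\{0,1\}$, one of two projective measurements $\vec v\cdot\vec\sigma$, $|\vec v|=1$, of their qubit, with outcomes $a_1,a_{n+1}\in\{0,1\}$. Each intermediate party $A_j$ ($2\le j\le n$) performs one Bell basis measurement of its two qubits, with respect to arbitrary local orthonormal bases of the two qubits (that is, up to local unitaries), with outcome $\vec a_j=(a_{j1},a_{j2})\in\{0,1\}^2$ for the Bell vector $(|0,a_{j1}\rangle+(-1)^{a_{j2}}|1,1-a_{j1}\rangle)/\sqrt2$ in these bases. With $p$ the resulting probabilities, for $i\in\{0,1\}$ put $$\langle D_{1,x_1}D_2^i\cdots D_n^iD_{n+1,x_{n+1}}\rangle=\sum_{a_1,\vec a_2,\dots,\vec a_n,a_{n+1}}(-1)^{a_1+a_{n+1}+\sum_{j=2}^n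 a_{j(i+1)}}\,p(a_1,\vec a_2,\dots,\vec a_n,a_{n+1}\mid x_1,x_{n+1}),$$ $$I_n=\tfrac14\sum_{x_1,x_{n+1}}\langle D_{1,x_1}D_2^0\cdots D_n^0D_{n+1,x_{n+1}}\rangle,\qquad J_n=\tfrac14\sum_{x_1,x_{n+1}}(-1)^{x_1+x_{n+1}}\langle D_{1,x_1}D_2^1\cdots D_n^1D_{n+1,x_{n+1}}\rangle .$$ Let $E_{i1}\ge E_{i2}$ be the two largest singular values of the correlation tensor $(\operatorname{Tr}[\rho_i\,\sigma_k\otimes\sigma_l])_{k,l=1}^3$ of $\rho_i$, and let $\mathcal C_i=\max\{0,\sqrt{\mu_1}-\sqrt{\mu_2}-\sqrt{\mu_3}-\sqrt{\mu_4}\}$ be the concurrence of $\rho_i$, where $\mu_1\ge\mu_2\ge\mu_3\ge\mu_4$ are the eigenvalues of $\rho_i(\sigma_2\otimes\sigma_2)\rho_i^{T}(\sigma_2\otimes\sigma_2)$. Then the maximum $\mathcal B_{n\text{-linear}}$ of the linear $n$-local expression $\sqrt{|I_n|}+\sqrt{|J_n|}$ over all these measurements is attained, and $$\mathcal B_{n\text{-linear}}=\sqrt{\prod_{i=1}^nE_{i1}+\prod_{i=1}^nE_{i2}}\;\le\;\sqrt{1+\prod_{i=1}^n\mathcal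 C_i}.$$ -/

import Mathlib

open scoped Matrix Kronecker ComplexOrder

noncomputable section

namespace QNetwork

/-- Operators on one qubit, in the computational basis. -/
abbrev QubitOp : Type := Matrix (Fin 2) (Fin 2) ℂ

/-- Operators on two qubits, in the computational product basis. -/
abbrev TwoQubitOp : Type := Matrix (Fin 2 × Fin 2) (Fin 2 × Fin 2) ℂ

/-- A two-qubit state (density matrix). -/
def IsState (ρ : TwoQubitOp) : Prop := ρ.PosSemidef ∧ ρ.trace = 1

/-- The Pauli matrices `σ₁, σ₂, σ₃`, indexed by `0, 1, 2`. -/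
def pauli : Fin 3 → QubitOp :=
  ![!![0, 1; 1, 0], !![0, -Complex.I; Complex.I, 0], !![1, 0; 0, -1]]

/-- The correlation tensor `r i j = Tr [ρ (σ i ⊗ σ j)]` (real for Hermitian `ρ`). -/
def corrTensor (ρ : TwoQubitOp) : Matrix (Fin 3) (Fin 3) ℝ :=
  Matrix.of fun i j => (ρ * (pauli i ⊗ₖ pauli j)).trace.re

/-- The ordered singular values `E 0 ≥ E 1 ≥ E 2` of the correlation tensor. -/
def corrSing (ρ : TwoQubitOp) (k : ℕ) : ℝ :=
  ((corrTensor ρ).toEuclideanLin).singularValues k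

/-- The matrix `ρ (σ₂ ⊗ σ₂) ρᵀ (σ₂ ⊗ σ₂)`; for a state `ρᵀ` is the entrywise conjugate of `ρ`. -/
def woottersMatrix (ρ : TwoQubitOp) : TwoQubitOp :=
  ρ * (pauli 1 ⊗ₖ pauli 1) * ρᵀ * (pauli 1 ⊗ₖ pauli 1)

/-- The square roots of the four eigenvalues (with algebraic multiplicity) of the Wootters matrix,
in decreasing order. For a state, these eigenvalues are real and nonnegative. -/
def woottersList (ρ : TwoQubitOp) : List ℝ :=
  ((woottersMatrix ρ).charpoly.roots.map fun z : ℂ => √z.re).sort (· ≥ ·)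

/-- The concurrence `max (0, √μ₁ - √μ₂ - √μ₃ - √μ₄)`, with `μ₁ ≥ μ₂ ≥ μ₃ ≥ μ₄` the eigenvalues of
the Wootters matrix. -/
def concurrence (ρ : TwoQubitOp) : ℝ :=
  max 0 ((woottersList ρ).getD 0 0 - (woottersList ρ).getD 1 0 - (woottersList ρ).getD 2 0
    - (woottersList ρ).getD 3 0)

/-- The projector for outcome `a` of the qubit measurement along the unit vector `v`. -/
def spinProj (v : EuclideanSpace ℝ (Fin 3)) (a : Fin 2) : QubitOp :=
  (1 / 2 : ℂ) • (1 + (-1 : ℂ) ^ (a : ℕ) • (∑ k, (v k : ℂ) • pauli k))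

/-- The Bell vectors `(|0, a₁⟩ + (-1) ^ a₂ |1, 1 - a₁⟩) / √2`, labelled by the two bits
`a₁ = a 0` and `a₂ = a 1`: the labels `00, 01, 10, 11` stand for `Φ⁺, Φ⁻, Ψ⁺, Ψ⁻`. -/
def bellVec (a : Fin 2 → Fin 2) : Fin 2 × Fin 2 → ℂ :=
  fun s => if s.2 = s.1 + a 0 then (-1 : ℂ) ^ ((a 1 : ℕ) * (s.1 : ℕ)) / (√2 : ℝ) else 0

/-- The projector for outcome `a` of the Bell basis measurement, in the local bases given by the
unitaries `U` and `V` on the two qubits, i.e. in the basis `(U ⊗ V) bellVec a`. -/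
def bellProj (U V : QubitOp) (a : Fin 2 → Fin 2) : TwoQubitOp :=
  Matrix.vecMulVec ((U ⊗ₖ V) *ᵥ bellVec a) (star ((U ⊗ₖ V) *ᵥ bellVec a))

/-- Basis labels of the `2 (m + 1)` qubits of a linear network with `m + 1` sources: `s i` holds the
labels of the left and of the right qubit sent by source `i`. The parties are: the first one, with
the left qubit of source `0`; for `j < m` an intermediate one, with the right qubit of source `j`
and the left qubit of source `j + 1`; the last one, with the right qubit of source `m`. -/
abbrev Labels (m : ℕ) : Type := Fin (m + 1) → Fin 2 × Fin 2

/-- The overall state `⊗ i, ρ i`. -/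
def networkState {m : ℕ} (ρ : Fin (m + 1) → TwoQubitOp) : Matrix (Labels m) (Labels m) ℂ :=
  Matrix.of fun s t => ∏ i, ρ i (s i) (t i)

/-- The tensor product of operators of the parties: `A` of the first party, `M j` of the
intermediate ones, and `B` of the last party. -/
def partyOp {m : ℕ} (A : QubitOp) (M : Fin m → TwoQubitOp) (B : QubitOp) :
    Matrix (Labels m) (Labels m) ℂ :=
  Matrix.of fun s t =>
    A (s 0).1 (t 0).1 *
      (∏ j : Fin m, M j ((s j.castSucc).2, (s j.succ).1) ((t j.castSucc).2, (t j.succ).1)) *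
      B (s (Fin.last m)).2 (t (Fin.last m)).2

/-- The measurements in the network: each extreme party has two projective measurements, along unit
vectors `a 0, a 1` and `b 0, b 1`; the intermediate party `j` makes one Bell basis measurement, in
local bases given by `U j` and `V j`. -/
structure Settings (m : ℕ) where
  a : Fin 2 → EuclideanSpace ℝ (Fin 3)
  norm_a : ∀ x, ‖a x‖ = 1
  b : Fin 2 → EuclideanSpace ℝ (Fin 3)
  norm_b : ∀ x, ‖b x‖ = 1
  U : Fin m → Matrix.unitaryGroup (Fin 2) ℂ
  V : Fin m → Matrix.unitaryGroup (Fin 2) ℂ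

variable {m : ℕ}

/-- The probability (by the Born rule) of the outcomes `α` of the first party, `β j` of the
intermediate ones and `γ` of the last party, for inputs `x` and `y` of the extreme parties. -/
def prob (ρ : Fin (m + 1) → TwoQubitOp) (S : Settings m) (α : Fin 2) (β : Fin m → Fin 2 → Fin 2)
    (γ : Fin 2) (x y : Fin 2) : ℝ :=
  (partyOp (spinProj (S.a x) α) (fun j => bellProj (S.U j) (S.V j) (β j)) (spinProj (S.b y) γ) *
    networkState ρ).trace.re

/-- The correlator of the outcomes of the extreme parties, for inputs `x` and `y`, and of the bits
`i` of the outcomes of all intermediate parties. -/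
def correlator (ρ : Fin (m + 1) → TwoQubitOp) (S : Settings m) (i x y : Fin 2) : ℝ :=
  ∑ α : Fin 2, ∑ β : Fin m → Fin 2 → Fin 2, ∑ γ : Fin 2,
    (-1 : ℝ) ^ ((α : ℕ) + (γ : ℕ) + ∑ j, (β j i : ℕ)) * prob ρ S α β γ x y

/-- The term `I` of the inequality. -/
def termI (ρ : Fin (m + 1) → TwoQubitOp) (S : Settings m) : ℝ :=
  (1 / 4 : ℝ) * ∑ x : Fin 2, ∑ y : Fin 2, correlator ρ S 0 x y

/-- The term `J` of the inequality. -/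
def termJ (ρ : Fin (m + 1) → TwoQubitOp) (S : Settings m) : ℝ :=
  (1 / 4 : ℝ) * ∑ x : Fin 2, ∑ y : Fin 2,
    (-1 : ℝ) ^ ((x : ℕ) + (y : ℕ)) * correlator ρ S 1 x y

/-- The left-hand side `√|I| + √|J|` of the linear `n`-local inequality `√|I| + √|J| ≤ 1`, for
`n = m + 1` sources. -/
def linearExpr (ρ : Fin (m + 1) → TwoQubitOp) (S : Settings m) : ℝ :=
  √|termI ρ S| + √|termJ ρ S|

/-- The quantity `√(∏ i, E i 1 + ∏ i, E i 2)`, where `E i 1 ≥ E i 2` are the two largest singular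
values of the correlation tensor of `ρ i`. -/
def boundLinear (ρ : Fin (m + 1) → TwoQubitOp) : ℝ :=
  √((∏ i, corrSing (ρ i) 0) + (∏ i, corrSing (ρ i) 1))

end QNetwork

end

open scoped Matrix Kronecker ComplexOrder

noncomputable section

namespace QNetwork

/-! Summed with the sign of one outcome bit, a Bell measurement becomes a product of spin
observables: `σ₃ ⊗ σ₃` for the first bit, `σ₁ ⊗ σ₁` for the second, up to local unitaries. So each
correlator is a product over the sources of numbers `⟨q, T p⟩`, with `T` the correlation tensor. The
extreme settings enter `I` through half sums `c a`, `d b` and `J` through half differences `s a'`,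
`t b'`, where `(a, a')`, `(b, b')` are orthonormal and `c² + s² = d² + t² = 1`. Since `cd + st ≤ 1`,
Cauchy-Schwarz leaves the root of a sum of two products, of `|⟨q, T p⟩|` and of `|⟨q', T p'⟩|`. Ky
Fan's inequality controls each source, and `prod_add_prod_le_of_weakMajorized` passes to products.
Singular vectors give equality, because every orthonormal pair comes from a unitary
(`exists_unitary_conj_eq_spinOp`).

The concurrence bound is the same majorization, fed with `E₁ ≤ 1` and `E₁ + E₂ ≤ 1 + C`
(`corrSing_bounds`). By Wootters' construction, `ρ = B Bᴴ` where the concurrences of the columns of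
`B` add up to at most `C` (`exists_factor_sum_norm_le_concurrence`). Local unitaries align the
singular directions with `σ₃` and `σ₁`, and for each column `⟨σ₃ ⊗ σ₃⟩ + ⟨σ₁ ⊗ σ₁⟩` is at most its
squared norm plus its concurrence. -/

/-! ### Weak majorization of pairs -/

/-- Abel summation, twice: if `X ≤ Y`, then `xX + yY = (x + y)X + y(Y - X) ≤ eY + fX = (e - f)Y +
f(X + Y)`, and the last expression is at most `eP + fQ`. -/
lemma mul_add_mul_le_of_weakMajorized {x y e f X Y P Q : ℝ} (hY : 0 ≤ Y) (hX : 0 ≤ X)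
    (hf : 0 ≤ f) (hfe : f ≤ e)
    (hxe : x ≤ e) (hye : y ≤ e) (hxy : x + y ≤ e + f) (hXP : X ≤ P) (hYP : Y ≤ P)
    (hXY : X + Y ≤ P + Q) : x * X + y * Y ≤ e * P + f * Q := by
  rcases le_total X Y with h | h
  · nlinarith [mul_nonneg (sub_nonneg.2 h) (sub_nonneg.2 hye), mul_nonneg hX (sub_nonneg.2 hxy),
      mul_nonneg (sub_nonneg.2 hfe) (sub_nonneg.2 hYP), mul_nonneg hf (sub_nonneg.2 hXY)]
  · nlinarith [mul_nonneg (sub_nonneg.2 h) (sub_nonneg.2 hxe), mul_nonneg hY (sub_nonneg.2 hxy),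
      mul_nonneg (sub_nonneg.2 hfe) (sub_nonneg.2 hXP), mul_nonneg hf (sub_nonneg.2 hXY)]

/-- Weak majorization of pairs of nonnegative numbers is stable under products. -/
lemma prod_add_prod_le_of_weakMajorized {ι : Type*} (s : Finset ι) (x y e f : ι → ℝ)
    (hx : ∀ i, 0 ≤ x i) (hy : ∀ i, 0 ≤ y i) (hf : ∀ i, 0 ≤ f i) (hfe : ∀ i, f i ≤ e i)
    (hxe : ∀ i, x i ≤ e i) (hye : ∀ i, y i ≤ e i) (hxy : ∀ i, x i + y i ≤ e i + f i) :
    ∏ i ∈ s, x i + ∏ i ∈ s, y i ≤ ∏ i ∈ s, e i + ∏ i ∈ s, f i := by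
  classical
  induction s using Finset.induction_on with
  | empty => simp
  | insert a s ha ih =>
    simp only [Finset.prod_insert ha]
    exact mul_add_mul_le_of_weakMajorized (Finset.prod_nonneg fun i _ => hy i)
      (Finset.prod_nonneg fun i _ => hx i) (hf a) (hfe a) (hxe a) (hye a) (hxy a)
      (Finset.prod_le_prod (fun i _ => hx i) fun i _ => hxe i)
      (Finset.prod_le_prod (fun i _ => hy i) fun i _ => hye i) ih

/-! ### Singular values and orthonormal pairs -/

section SVD

variable {E : Type*} [NormedAddCommGroup E] [InnerProductSpace ℝ E]

/-- An orthonormal pair. -/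
def OrthPair (q q' : E) : Prop := ‖q‖ = 1 ∧ ‖q'‖ = 1 ∧ inner ℝ q q' = 0

lemma OrthPair.inner_sq_add_inner_sq_le {q q' : E} (h : OrthPair q q') (x : E) :
    inner ℝ x q ^ 2 + inner ℝ x q' ^ 2 ≤ ‖x‖ ^ 2 := by
  obtain ⟨h1, h2, h3⟩ := h
  have ho : Orthonormal ℝ ![q, q'] := by
    rw [orthonormal_vecCons_iff]
    simp [h1, h2, h3]
  have := ho.sum_inner_products_le x (s := Finset.univ)
  simpa [Fin.sum_univ_two, real_inner_comm] using this

variable [FiniteDimensional ℝ E]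

/-- Singular value decomposition of an endomorphism of a Euclidean space. -/
lemma exists_singularValue_decomposition {n : ℕ} (hn : Module.finrank ℝ E = n) (T : E →ₗ[ℝ] E) :
    ∃ u v : OrthonormalBasis (Fin n) ℝ E, ∀ k, T (v k) = T.singularValues k • u k := by
  set hT := T.isSymmetric_adjoint_comp_self
  set v := hT.eigenvectorBasis hn
  have key : ∀ i j, inner ℝ (T (v i)) (T (v j)) =
      if i = j then T.singularValues i ^ 2 else 0 := by
    intro i j
    have h1 : inner ℝ (T (v i)) (T (v j)) = inner ℝ ((T.adjoint ∘ₗ T) (v i)) (v j) := by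
      simp [LinearMap.adjoint_inner_left]
    rw [h1, hT.apply_eigenvectorBasis hn i, T.sq_singularValues_fin hn i, inner_smul_left,
      orthonormal_iff_ite.1 v.orthonormal]
    split_ifs <;> simp
  let w : Fin n → E := fun k => (T.singularValues k)⁻¹ • T (v k)
  -- Only nonzero singular values give a normalized image; the basis extension supplies the other `u
  -- k`, for which `T (v k) = 0`.
  let s : Set (Fin n) := {k | T.singularValues k ≠ 0}
  have hw : Orthonormal ℝ (s.domRestrict w) := by
    rw [orthonormal_iff_ite]
    rintro ⟨i, hi⟩ ⟨j, hj⟩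
    simp only [Set.domRestrict_apply, w, inner_smul_left, inner_smul_right, key, Subtype.mk.injEq]
    have hi' : T.singularValues i ≠ 0 := hi
    split_ifs with h
    · subst h
      simp only [RCLike.conj_to_real]
      field_simp
    · simp
  obtain ⟨u, hu⟩ := hw.exists_orthonormalBasis_extension_of_card_eq (by simp [hn])
  refine ⟨u, v, fun k => ?_⟩
  by_cases hk : T.singularValues k = 0
  · have := key k k
    simp only [if_true, hk] at this
    rw [hk, zero_smul]
    exact inner_self_eq_zero.1 (this.trans (by norm_num))
  · rw [hu k hk, smul_smul, mul_inv_cancel₀ hk, one_smul]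

/-- In singular bases the form is `∑ sₖ ⟨vₖ, p⟩⟨uₖ, q⟩`; AM-GM turns the coefficients into weights
of total 1. -/
lemma abs_inner_le_singularValue {n : ℕ} (hn : Module.finrank ℝ E = n) (T : E →ₗ[ℝ] E) (q p : E)
    (hq : ‖q‖ = 1) (hp : ‖p‖ = 1) : |inner ℝ q (T p)| ≤ T.singularValues 0 := by
  obtain ⟨u, v, h⟩ := exists_singularValue_decomposition hn T
  have hpq : inner ℝ q (T p) =
      ∑ k : Fin n, T.singularValues k * (inner ℝ (v k) p * inner ℝ (u k) q) := by
    conv_lhs => rw [← v.sum_repr' p]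
    simp only [map_sum, map_smul, h, inner_sum, inner_smul_right]
    exact Finset.sum_congr rfl fun k _ => by rw [real_inner_comm q]; ring
  rw [hpq]
  have h1 : ∑ k, inner ℝ (v k) p ^ 2 = 1 := by
    have := v.sum_sq_norm_inner_right p
    simpa [hp] using this
  have h2 : ∑ k, inner ℝ (u k) q ^ 2 = 1 := by
    have := u.sum_sq_norm_inner_right q
    simpa [hq] using this
  calc |∑ k : Fin n, T.singularValues k * (inner ℝ (v k) p * inner ℝ (u k) q)|
      ≤ ∑ k : Fin n, |T.singularValues k * (inner ℝ (v k) p * inner ℝ (u k) q)| :=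
        Finset.abs_sum_le_sum_abs _ _
    _ ≤ ∑ k : Fin n, T.singularValues 0 * ((inner ℝ (v k) p ^ 2 + inner ℝ (u k) q ^ 2) / 2) := by
        refine Finset.sum_le_sum fun k _ => ?_
        rw [abs_mul, abs_of_nonneg (T.singularValues_nonneg _)]
        refine mul_le_mul (T.singularValues_antitone (Nat.zero_le _)) ?_ (abs_nonneg _)
          (T.singularValues_nonneg _)
        rw [abs_le]
        constructor <;> nlinarith [sq_nonneg (inner ℝ (v k) p + inner ℝ (u k) q),
          sq_nonneg (inner ℝ (v k) p - inner ℝ (u k) q)]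
    _ = T.singularValues 0 := by
        rw [← Finset.mul_sum, ← Finset.sum_div, Finset.sum_add_distrib, h1, h2]
        norm_num

/-- Ky Fan's inequality for the two largest singular values, in dimension three. -/
lemma abs_inner_add_abs_inner_le (hn : Module.finrank ℝ E = 3) (T : E →ₗ[ℝ] E) {q q' p p' : E}
    (hq : OrthPair q q') (hp : OrthPair p p') :
    |inner ℝ q (T p)| + |inner ℝ q' (T p')| ≤ T.singularValues 0 + T.singularValues 1 := by
  obtain ⟨u, v, h⟩ := exists_singularValue_decomposition hn T
  have hpq (q p : E) : |inner ℝ q (T p)| ≤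
      ∑ k : Fin 3, T.singularValues k * ((inner ℝ (v k) p ^ 2 + inner ℝ (u k) q ^ 2) / 2) := by
    conv_lhs => rw [← v.sum_repr' p]
    simp only [map_sum, map_smul, h, inner_sum, inner_smul_right]
    refine (Finset.abs_sum_le_sum_abs _ _).trans (Finset.sum_le_sum fun k _ => ?_)
    rw [mul_left_comm, abs_mul, abs_of_nonneg (T.singularValues_nonneg _)]
    refine mul_le_mul_of_nonneg_left ?_ (T.singularValues_nonneg _)
    rw [abs_le, real_inner_comm (u k) q]
    constructor <;> nlinarith [sq_nonneg (inner ℝ (v k) p + inner ℝ (u k) q),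
      sq_nonneg (inner ℝ (v k) p - inner ℝ (u k) q)]
  have hsum (b : OrthonormalBasis (Fin 3) ℝ E) (x : E) (hx : ‖x‖ = 1) :
      ∑ k, inner ℝ (b k) x ^ 2 = 1 := by
    have := b.sum_sq_norm_inner_right x
    simpa [hx] using this
  have hv (k) : inner ℝ (v k) p ^ 2 + inner ℝ (v k) p' ^ 2 ≤ 1 := by
    simpa using hp.inner_sq_add_inner_sq_le (v k)
  have hu (k) : inner ℝ (u k) q ^ 2 + inner ℝ (u k) q' ^ 2 ≤ 1 := by
    simpa using hq.inner_sq_add_inner_sq_le (u k)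
  have e1 := hsum v p hp.1
  have e2 := hsum v p' hp.2.1
  have e3 := hsum u q hq.1
  have e4 := hsum u q' hq.2.1
  refine (add_le_add (hpq q p) (hpq q' p')).trans ?_
  simp only [Fin.sum_univ_three] at *
  have h01 : T.singularValues 1 ≤ T.singularValues 0 := T.singularValues_antitone (by norm_num)
  have h12 : T.singularValues 2 ≤ T.singularValues 1 := T.singularValues_antitone (by norm_num)
  have v0 := hv 0
  have v2 := hv 2
  have u0 := hu 0
  have u2 := hu 2
  simp only [Fin.val_zero, Fin.val_one, Fin.val_two]
  -- The three weights add up to 2. Bessel's inequality gives `a0 ≤ 1`, so the weighted sum falls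
  -- short of `s₀ + s₁` by at least `(s₀ - s₁)(1 - a0) + (s₁ - s₂) a2 ≥ 0`.
  set a0 := (inner ℝ (v 0) p ^ 2 + inner ℝ (v 0) p' ^ 2 + inner ℝ (u 0) q ^ 2 +
    inner ℝ (u 0) q' ^ 2) / 2
  set a2 := (inner ℝ (v 2) p ^ 2 + inner ℝ (v 2) p' ^ 2 + inner ℝ (u 2) q ^ 2 +
    inner ℝ (u 2) q' ^ 2) / 2 with ha2
  have i0 : a0 ≤ 1 := by simp only [a0]; linarith
  have i2 : 0 ≤ a2 := by positivity
  have main : T.singularValues 0 * a0 + T.singularValues 1 * (2 - a0 - a2) +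
      T.singularValues 2 * a2 ≤ T.singularValues 0 + T.singularValues 1 := by
    nlinarith [mul_nonneg (sub_nonneg.2 h01) (sub_nonneg.2 i0),
      mul_nonneg (sub_nonneg.2 h12) i2]
  refine le_trans (le_of_eq ?_) main
  have hmid : 2 - a0 - a2 = (inner ℝ (v 1) p ^ 2 + inner ℝ (v 1) p' ^ 2 + inner ℝ (u 1) q ^ 2 +
      inner ℝ (u 1) q' ^ 2) / 2 := by
    simp only [a0, a2]; linarith
  rw [hmid]
  simp only [a0, a2]
  ring

lemma exists_orthPair_singular (hn : Module.finrank ℝ E = 3) (T : E →ₗ[ℝ] E) :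
    ∃ q q' p p' : E, OrthPair q q' ∧ OrthPair p p' ∧
      inner ℝ q (T p) = T.singularValues 0 ∧ inner ℝ q' (T p') = T.singularValues 1 := by
  obtain ⟨u, v, h⟩ := exists_singularValue_decomposition hn T
  have hb (b : OrthonormalBasis (Fin 3) ℝ E) : OrthPair (b 0) (b 1) :=
    ⟨b.orthonormal.1 0, b.orthonormal.1 1, b.orthonormal.2 (by decide)⟩
  refine ⟨u 0, u 1, v 0, v 1, hb u, hb v, ?_, ?_⟩
  · rw [h, inner_smul_right, real_inner_self_eq_norm_sq, u.orthonormal.1]; simp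
  · rw [h, inner_smul_right, real_inner_self_eq_norm_sq, u.orthonormal.1]; simp

/-- Two orthogonal vectors are multiples of an orthonormal pair. -/
lemma exists_orthPair_of_inner_eq_zero (hn : Module.finrank ℝ E = 3) {x y : E}
    (h : inner ℝ x y = 0) : ∃ q q' : E, OrthPair q q' ∧ x = ‖x‖ • q ∧ y = ‖y‖ • q' := by
  -- The entry 0 is a filler. Zero vectors lie outside `s`, so the basis extension replaces them by
  -- suitable unit vectors.
  let w : Fin 3 → E := ![‖x‖⁻¹ • x, ‖y‖⁻¹ • y, 0]
  let s : Set (Fin 3) := {k | w k ≠ 0}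
  have hw : Orthonormal ℝ (s.domRestrict w) := by
    constructor
    · rintro ⟨i, hi⟩
      have hi' : w i ≠ 0 := hi
      fin_cases i
      · have : x ≠ 0 := by rintro rfl; simp [w] at hi'
        simp [w, Set.domRestrict, norm_smul, this]
      · have : y ≠ 0 := by rintro rfl; simp [w] at hi'
        simp [w, Set.domRestrict, norm_smul, this]
      · simp [w] at hi'
    · rintro ⟨i, hi⟩ ⟨j, hj⟩ hij
      have h' : inner ℝ y x = 0 := by rw [real_inner_comm, h]
      fin_cases i <;> fin_cases j <;>
        simp_all [w, Set.domRestrict, inner_smul_left, inner_smul_right]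
  obtain ⟨b, hb⟩ := hw.exists_orthonormalBasis_extension_of_card_eq (by simp [hn])
  refine ⟨b 0, b 1, ⟨b.orthonormal.1 0, b.orthonormal.1 1, b.orthonormal.2 (by decide)⟩, ?_, ?_⟩
  · by_cases hx : x = 0
    · simp [hx]
    · have hx' : ‖x‖ ≠ 0 := norm_ne_zero_iff.2 hx
      rw [hb 0 (by simp [s, w, hx]), show w 0 = ‖x‖⁻¹ • x from rfl, smul_smul,
        mul_inv_cancel₀ hx', one_smul]
  · by_cases hy : y = 0
    · simp [hy]
    · have hy' : ‖y‖ ≠ 0 := norm_ne_zero_iff.2 hy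
      rw [hb 1 (by simp [s, w, hy]), show w 1 = ‖y‖⁻¹ • y from rfl, smul_smul,
        mul_inv_cancel₀ hy', one_smul]

end SVD

/-! ### Spin observables and local unitaries -/

/-- The observable `q · σ`. -/
def spinOp (q : EuclideanSpace ℝ (Fin 3)) : QubitOp := ∑ k, (q k : ℂ) • pauli k

lemma spinOp_eq (q : EuclideanSpace ℝ (Fin 3)) :
    spinOp q = !![(q 2 : ℂ), q 0 - Complex.I * q 1; q 0 + Complex.I * q 1, -(q 2 : ℂ)] := by
  ext i j
  fin_cases i <;> fin_cases j <;> simp [spinOp, pauli, Fin.sum_univ_three, Matrix.sum_apply] <;> ring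

lemma inner_eq_three (q p : EuclideanSpace ℝ (Fin 3)) :
    inner ℝ q p = q 0 * p 0 + q 1 * p 1 + q 2 * p 2 := by
  simp [PiLp.inner_apply, Fin.sum_univ_three]
  ring

lemma trace_spinOp_mul_spinOp (q p : EuclideanSpace ℝ (Fin 3)) :
    (spinOp q * spinOp p).trace = 2 * (inner ℝ q p : ℝ) := by
  rw [spinOp_eq, spinOp_eq, inner_eq_three, Matrix.mul_fin_two, Matrix.trace_fin_two]
  push_cast
  simp only [Matrix.of_apply, Matrix.cons_val', Matrix.cons_val_zero, Matrix.cons_val_one,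
    Matrix.cons_val_fin_one]
  linear_combination (-2 * (q 1 : ℂ) * p 1) * Complex.I_mul_I

lemma exists_spinOp_eq {H : QubitOp} (hH : H.IsHermitian) (htr : H.trace = 0) :
    ∃ q, spinOp q = H := by
  refine ⟨!₂[(H 1 0).re, (H 1 0).im, (H 0 0).re], ?_⟩
  rw [spinOp_eq]
  have h00 := congrFun (congrFun hH 0) 0
  have h01 := congrFun (congrFun hH 0) 1
  rw [Matrix.trace_fin_two] at htr
  simp only [Matrix.conjTranspose_apply] at h00 h01
  have e0 : ((H 0 0).re : ℂ) = H 0 0 := Complex.conj_eq_iff_re.1 h00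
  ext i j
  fin_cases i <;> fin_cases j
  · simpa using e0
  · have r := congrArg Complex.re h01
    have i := congrArg Complex.im h01
    simp only [Complex.star_def, Complex.conj_re, Complex.conj_im] at r i
    apply Complex.ext <;> simp [r, i]
  · apply Complex.ext <;> simp
  · simp only [Fin.mk_one, Matrix.of_apply, Matrix.cons_val', Matrix.cons_val_one,
      Matrix.cons_val_fin_one]
    simp only [Matrix.cons_val, e0]
    linear_combination -htr

lemma pauli_isHermitian (k : Fin 3) : (pauli k).IsHermitian := by
  fin_cases k <;> ext i j <;> fin_cases i <;> fin_cases j <;> simp [pauli]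

lemma pauli_trace (k : Fin 3) : (pauli k).trace = 0 := by
  fin_cases k <;> simp [pauli, Matrix.trace_fin_two]

lemma trace_pauli_mul_pauli (k l : Fin 3) :
    (pauli k * pauli l).trace = if k = l then 2 else 0 := by
  fin_cases k <;> fin_cases l <;> norm_num [pauli, Matrix.trace_fin_two, Matrix.mul_apply]

/-- Conjugation by a unitary rotates Bloch vectors: it preserves traces of products, which are twice
the inner products. -/
lemma exists_spinOp_eq_conj (U : Matrix.unitaryGroup (Fin 2) ℂ) :
    ∃ q q' : EuclideanSpace ℝ (Fin 3), OrthPair q q' ∧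
      spinOp q = (U : QubitOp) * pauli 2 * (U : QubitOp)ᴴ ∧
      spinOp q' = (U : QubitOp) * pauli 0 * (U : QubitOp)ᴴ := by
  have hU : (U : QubitOp)ᴴ * (U : QubitOp) = 1 := Matrix.UnitaryGroup.star_mul_self U
  have hex (k) : ∃ q, spinOp q = (U : QubitOp) * pauli k * (U : QubitOp)ᴴ := by
    refine exists_spinOp_eq (Matrix.isHermitian_mul_mul_conjTranspose _ (pauli_isHermitian k)) ?_
    rw [Matrix.trace_mul_comm, ← mul_assoc, hU, one_mul, pauli_trace]
  choose f hf using hex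
  have hin (k l) : inner ℝ (f k) (f l) = if k = l then 1 else 0 := by
    have h1 := trace_spinOp_mul_spinOp (f k) (f l)
    have h2 : (U : QubitOp) * pauli k * (U : QubitOp)ᴴ * ((U : QubitOp) * pauli l * (U : QubitOp)ᴴ)
        = (U : QubitOp) * (pauli k * pauli l) * (U : QubitOp)ᴴ := by
      simp only [mul_assoc]
      rw [← mul_assoc (U : QubitOp)ᴴ, hU, one_mul]
    rw [hf, hf, h2, Matrix.trace_mul_comm, ← mul_assoc, hU, one_mul, trace_pauli_mul_pauli] at h1
    have h3 : (2 : ℂ) * (if k = l then 1 else 0 : ℝ) = 2 * (inner ℝ (f k) (f l) : ℝ) := by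
      rw [← h1]; split_ifs <;> simp
    exact_mod_cast (mul_left_cancel₀ two_ne_zero h3).symm
  have hn (k) : ‖f k‖ = 1 := by
    have := hin k k
    rw [real_inner_self_eq_norm_sq, if_pos rfl] at this
    nlinarith [norm_nonneg (f k)]
  exact ⟨f 2, f 0, ⟨hn 2, hn 0, by rw [hin, if_neg (by decide)]⟩, hf 2, hf 0⟩

lemma spinOp_mul_spinOp_add (q p : EuclideanSpace ℝ (Fin 3)) :
    spinOp q * spinOp p + spinOp p * spinOp q = (2 * (inner ℝ q p : ℝ) : ℂ) • 1 := by
  rw [spinOp_eq, spinOp_eq, inner_eq_three, Matrix.mul_fin_two, Matrix.mul_fin_two]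
  ext i j
  fin_cases i <;> fin_cases j <;> simp
  · linear_combination (-2 * (q 1 : ℂ) * p 1) * Complex.I_mul_I
  · ring
  · ring
  · linear_combination (-2 * (q 1 : ℂ) * p 1) * Complex.I_mul_I

lemma spinOp_mul_self {q : EuclideanSpace ℝ (Fin 3)} (hq : ‖q‖ = 1) : spinOp q * spinOp q = 1 := by
  have := spinOp_mul_spinOp_add q q
  rw [real_inner_self_eq_norm_sq, hq, ← two_smul ℂ] at this
  exact smul_right_injective _ (two_ne_zero (α := ℂ)) (by simpa using this)

lemma spinOp_isHermitian (q : EuclideanSpace ℝ (Fin 3)) : (spinOp q).IsHermitian := by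
  rw [spinOp_eq]
  ext i j
  fin_cases i <;> fin_cases j <;> simp [sub_eq_add_neg]

/-- Take a unit vector `e` fixed by `q · σ` and put `f = (q' · σ) e`. Orthogonality makes the
observables anticommute, so `f` has eigenvalue -1 for `q · σ`, while `q' · σ` swaps `e` and `f`. The
columns of the unitary are `e` and `f`. -/
lemma exists_unitary_conj_eq_spinOp {q q' : EuclideanSpace ℝ (Fin 3)} (h : OrthPair q q') :
    ∃ U : Matrix.unitaryGroup (Fin 2) ℂ,
      spinOp q = (U : QubitOp) * pauli 2 * (U : QubitOp)ᴴ ∧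
      spinOp q' = (U : QubitOp) * pauli 0 * (U : QubitOp)ᴴ := by
  obtain ⟨h1, h2, h3⟩ := h
  have hdet : (spinOp q - 1).det = 0 := by
    rw [spinOp_eq, Matrix.det_fin_two]
    have : q 0 * q 0 + q 1 * q 1 + q 2 * q 2 = 1 := by
      rw [← inner_eq_three, real_inner_self_eq_norm_sq, h1, one_pow]
    have h' := congrArg Complex.ofReal this
    push_cast at h'
    simp
    linear_combination (-1 : ℂ) * h' + (q 1 * q 1 : ℂ) * Complex.I_mul_I
  obtain ⟨w, hw0, hw⟩ := Matrix.exists_mulVec_eq_zero_iff.2 hdet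
  rw [Matrix.sub_mulVec, Matrix.one_mulVec, sub_eq_zero] at hw
  obtain ⟨e, he, hQe⟩ : ∃ e : Fin 2 → ℂ, star e ⬝ᵥ e = 1 ∧ spinOp q *ᵥ e = e := by
    have hn : ‖WithLp.toLp 2 w‖ ≠ 0 := by
      rw [norm_ne_zero_iff]; intro hh; exact hw0 (by simpa using hh)
    refine ⟨((‖WithLp.toLp 2 w‖⁻¹ : ℝ) : ℂ) • w, ?_, by rw [Matrix.mulVec_smul, hw]⟩
    have h4 : star w ⬝ᵥ w = ((‖WithLp.toLp 2 w‖ ^ 2 : ℝ) : ℂ) := by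
      rw [EuclideanSpace.norm_sq_eq]
      simp [dotProduct, Complex.conj_mul']
    rw [star_smul, smul_dotProduct, dotProduct_smul, h4]
    simp only [smul_eq_mul, Complex.star_def, Complex.conj_ofReal]
    norm_cast
    field_simp
  set f := spinOp q' *ᵥ e with hf
  have hanti : spinOp q * spinOp q' = -(spinOp q' * spinOp q) := by
    have := spinOp_mul_spinOp_add q q'
    rw [h3] at this
    simpa [eq_neg_iff_add_eq_zero] using this
  have hQf : spinOp q *ᵥ f = -f := by
    rw [hf, Matrix.mulVec_mulVec, hanti, Matrix.neg_mulVec, ← Matrix.mulVec_mulVec, hQe]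
  have hPf : spinOp q' *ᵥ f = e := by
    rw [hf, Matrix.mulVec_mulVec, spinOp_mul_self h2, Matrix.one_mulVec]
  have hadj (r : EuclideanSpace ℝ (Fin 3)) (x y : Fin 2 → ℂ) :
      star (spinOp r *ᵥ x) ⬝ᵥ y = star x ⬝ᵥ (spinOp r *ᵥ y) := by
    rw [Matrix.star_mulVec, (spinOp_isHermitian r).eq, Matrix.dotProduct_mulVec]
  have hff : star f ⬝ᵥ f = 1 := by rw [hf, hadj, ← hf, hPf, he]
  have hef : star e ⬝ᵥ f = 0 := by
    have h4 := hadj q e f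
    rw [hQe, hQf, dotProduct_neg] at h4
    linear_combination h4 / 2
  have hfe : star f ⬝ᵥ e = 0 := by
    have h4 := hadj q f e
    rw [hQe, hQf, star_neg, neg_dotProduct] at h4
    linear_combination -h4 / 2
  let M : QubitOp := !![e 0, f 0; e 1, f 1]
  have hM : Mᴴ * M = 1 := by
    simp only [dotProduct, Fin.sum_univ_two, Pi.star_apply] at he hff hef hfe
    ext i j
    fin_cases i <;> fin_cases j <;> simp [M, Matrix.mul_apply, Fin.sum_univ_two]
    · exact he
    · exact hef
    · exact hfe
    · exact hff
  have hM' : M * Mᴴ = 1 := mul_eq_one_comm.1 hM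
  refine ⟨⟨M, (Matrix.mem_unitaryGroup_iff).2 hM'⟩, ?_, ?_⟩
  · have : spinOp q * M = M * pauli 2 := by
      ext i j
      have e1 := congrFun hQe i
      have e2 := congrFun hQf i
      simp only [Matrix.mulVec, dotProduct, Fin.sum_univ_two, Pi.neg_apply] at e1 e2
      fin_cases i <;> fin_cases j <;> simp [M, Matrix.mul_apply, Fin.sum_univ_two, pauli]
      · exact e1
      · exact e2
      · exact e1
      · exact e2
    rw [← this, mul_assoc, hM', mul_one]
  · have : spinOp q' * M = M * pauli 0 := by
      ext i j
      have e1 := congrFun hPf i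
      have e2 := congrFun hf i
      simp only [Matrix.mulVec, dotProduct, Fin.sum_univ_two] at e1 e2
      fin_cases i <;> fin_cases j <;> simp [M, Matrix.mul_apply, Fin.sum_univ_two, pauli]
      · exact e2.symm
      · exact e1
      · exact e2.symm
      · exact e1
    rw [← this, mul_assoc, hM', mul_one]

lemma trace_mul_kronecker_spinOp {ρ : TwoQubitOp} (hρ : ρ.IsHermitian)
    (q p : EuclideanSpace ℝ (Fin 3)) :
    (ρ * (spinOp q ⊗ₖ spinOp p)).trace =
      (inner ℝ q ((corrTensor ρ).toEuclideanLin p) : ℝ) := by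
  have hreal (k l) : (ρ * (pauli k ⊗ₖ pauli l)).trace = (corrTensor ρ k l : ℂ) := by
    refine (Complex.conj_eq_iff_re.1 ?_).symm
    rw [← Complex.star_def, ← Matrix.trace_conjTranspose, Matrix.conjTranspose_mul,
      Matrix.conjTranspose_kronecker, (pauli_isHermitian k).eq, (pauli_isHermitian l).eq,
      hρ.eq, Matrix.trace_mul_comm]
  have hk : spinOp q ⊗ₖ spinOp p = ∑ k, ∑ l, ((q k : ℂ) * p l) • (pauli k ⊗ₖ pauli l) := by
    ext i j
    simp only [spinOp, Matrix.kroneckerMap_apply, Matrix.sum_apply, Matrix.smul_apply, smul_eq_mul,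
      Finset.sum_mul_sum]
    exact Finset.sum_congr rfl fun _ _ => Finset.sum_congr rfl fun _ _ => by ring
  rw [hk]
  simp only [Finset.mul_sum, Matrix.trace_sum, Matrix.mul_smul, Matrix.trace_smul, hreal,
    smul_eq_mul]
  simp only [PiLp.inner_apply, Matrix.toLpLin_apply, Matrix.mulVec, dotProduct,
    RCLike.inner_apply, Complex.ofReal_sum, Complex.ofReal_mul, Finset.sum_mul,
    conj_trivial]
  exact Finset.sum_congr rfl fun _ _ => Finset.sum_congr rfl fun _ _ => by ring

/-! ### From outcome projectors to observables -/

lemma sum_spinProj (v : EuclideanSpace ℝ (Fin 3)) :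
    ∑ α : Fin 2, (-1 : ℂ) ^ (α : ℕ) • spinProj v α = spinOp v := by
  have h : ∑ k, (v k : ℂ) • pauli k = spinOp v := rfl
  simp only [Fin.sum_univ_two, spinProj, h]
  ext i j
  simp
  ring

lemma bellProj_eq (U V : QubitOp) (a : Fin 2 → Fin 2) :
    bellProj U V a =
      (U ⊗ₖ V) * Matrix.vecMulVec (bellVec a) (star (bellVec a)) * (U ⊗ₖ V)ᴴ := by
  rw [bellProj, Matrix.mul_vecMulVec, Matrix.vecMulVec_mul, Matrix.star_mulVec]

/-- The Pauli matrix measured on each qubit by a bit of the Bell measurement outcome. -/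
def bellPauli (i : Fin 2) : QubitOp := ![pauli 2, pauli 0] i

/-- These are spectral decompositions: Bell vectors are joint eigenvectors of `σ₃ ⊗ σ₃` and `σ₁ ⊗
σ₁`, with eigenvalues `(-1) ^ a₁` and `(-1) ^ a₂`. -/
lemma sum_bellVec (i : Fin 2) :
    ∑ a : Fin 2 → Fin 2, (-1 : ℂ) ^ (a i : ℕ) • Matrix.vecMulVec (bellVec a) (star (bellVec a)) =
      bellPauli i ⊗ₖ bellPauli i := by
  have h2 : ((√2 : ℝ) : ℂ)⁻¹ * ((√2 : ℝ) : ℂ)⁻¹ = 1 / 2 := by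
    rw [← mul_inv, ← Complex.ofReal_mul, Real.mul_self_sqrt (by norm_num)]; norm_num
  rw [← (finTwoArrowEquiv (Fin 2)).symm.sum_comp, Fintype.sum_prod_type]
  ext ⟨s1, s2⟩ ⟨t1, t2⟩
  fin_cases i <;> fin_cases s1 <;> fin_cases s2 <;> fin_cases t1 <;> fin_cases t2 <;>
    simp [bellVec, Matrix.vecMulVec_apply, bellPauli, pauli, h2, div_eq_mul_inv] <;> norm_num

lemma sum_bellProj (U V : QubitOp) (i : Fin 2) :
    ∑ a : Fin 2 → Fin 2, (-1 : ℂ) ^ (a i : ℕ) • bellProj U V a =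
      (U * bellPauli i * Uᴴ) ⊗ₖ (V * bellPauli i * Vᴴ) := by
  simp only [bellProj_eq]
  rw [Matrix.mul_kronecker_mul, Matrix.mul_kronecker_mul, ← sum_bellVec,
    Matrix.conjTranspose_kronecker]
  simp only [Matrix.mul_sum, Matrix.sum_mul, Matrix.mul_smul, Matrix.smul_mul]

/-! ### Factorization of correlators over the sources -/

variable {m : ℕ}

/-- Regrouping from parties to sources: party `j` holds the right qubit of source `j` and the left
one of source `j + 1`, whence `Fin.snoc` on the right and `Fin.cons` on the left. -/
lemma partyOp_kronecker (A : QubitOp) (P Q : Fin m → QubitOp) (B : QubitOp) :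
    partyOp A (fun j => P j ⊗ₖ Q j) B = Matrix.of fun s t : Labels m =>
      ∏ i, ((Fin.cons A Q : Fin (m + 1) → QubitOp) i ⊗ₖ
        (Fin.snoc P B : Fin (m + 1) → QubitOp) i) (s i) (t i) := by
  ext s t
  simp only [partyOp, Matrix.of_apply, Matrix.kroneckerMap_apply, Finset.prod_mul_distrib]
  rw [Fin.prod_univ_succ fun i => (Fin.cons A Q : Fin (m + 1) → QubitOp) i (s i).1 (t i).1,
    Fin.prod_univ_castSucc fun i => (Fin.snoc P B : Fin (m + 1) → QubitOp) i (s i).2 (t i).2]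
  simp only [Fin.cons_zero, Fin.cons_succ, Fin.snoc_castSucc, Fin.snoc_last]
  ring

lemma trace_prod_mul_networkState (X ρ : Fin (m + 1) → TwoQubitOp) :
    ((Matrix.of fun s t : Labels m => ∏ i, X i (s i) (t i)) * networkState ρ).trace =
      ∏ i, (X i * ρ i).trace := by
  simp only [Matrix.trace, Matrix.diag_apply, Matrix.mul_apply, networkState, Matrix.of_apply,
    ← Finset.prod_mul_distrib]
  rw [Finset.prod_univ_sum, Fintype.piFinset_univ]
  refine Finset.sum_congr rfl fun s _ => ?_
  rw [Finset.prod_univ_sum, Fintype.piFinset_univ]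

lemma sum_partyOp (A B : Fin 2 → QubitOp) (M : Fin m → (Fin 2 → Fin 2) → TwoQubitOp)
    (i : Fin 2) :
    ∑ α : Fin 2, ∑ β : Fin m → Fin 2 → Fin 2, ∑ γ : Fin 2,
      (-1 : ℂ) ^ ((α : ℕ) + (γ : ℕ) + ∑ j, (β j i : ℕ)) •
        partyOp (A α) (fun j => M j (β j)) (B γ) =
    partyOp (∑ α : Fin 2, (-1 : ℂ) ^ (α : ℕ) • A α)
      (fun j => ∑ b : Fin 2 → Fin 2, (-1 : ℂ) ^ (b i : ℕ) • M j b)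
      (∑ γ : Fin 2, (-1 : ℂ) ^ (γ : ℕ) • B γ) := by
  ext s t
  simp only [Matrix.sum_apply, Matrix.smul_apply, partyOp, Matrix.of_apply, smul_eq_mul]
  rw [Finset.prod_univ_sum, Fintype.piFinset_univ, Finset.sum_mul_sum, Finset.sum_mul]
  refine Finset.sum_congr rfl fun α _ => ?_
  rw [Finset.sum_mul]
  refine Finset.sum_congr rfl fun β _ => ?_
  rw [Finset.mul_sum]
  refine Finset.sum_congr rfl fun γ _ => ?_
  rw [pow_add, pow_add, ← Finset.prod_pow_eq_pow_sum, Finset.prod_mul_distrib]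
  ring

lemma correlator_eq (ρ : Fin (m + 1) → TwoQubitOp) (S : Settings m) (i x y : Fin 2) :
    correlator ρ S i x y = (∏ k, ((Fin.cons (spinOp (S.a x))
      (fun j => (S.V j : QubitOp) * bellPauli i * (S.V j : QubitOp)ᴴ) : Fin (m + 1) → QubitOp) k ⊗ₖ
      (Fin.snoc (fun j => (S.U j : QubitOp) * bellPauli i * (S.U j : QubitOp)ᴴ)
        (spinOp (S.b y)) : Fin (m + 1) → QubitOp) k * ρ k).trace).re := by
  rw [← trace_prod_mul_networkState, ← partyOp_kronecker]
  simp only [← sum_bellProj, ← sum_spinProj]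
  rw [← sum_partyOp]
  simp only [Finset.sum_mul, Matrix.trace_sum, Complex.re_sum, Matrix.smul_mul, Matrix.trace_smul,
    smul_eq_mul, correlator, prob]
  refine Finset.sum_congr rfl fun α _ => Finset.sum_congr rfl fun β _ =>
    Finset.sum_congr rfl fun γ _ => ?_
  rw [← Complex.re_ofReal_mul]
  push_cast
  rfl

/-- The product of the correlations of the sources, when the intermediate parties measure along
`p j` and `q j`, and the extreme ones along `a` and `b`. -/
def chain (ρ : Fin (m + 1) → TwoQubitOp) (q p : Fin m → EuclideanSpace ℝ (Fin 3))
    (a b : EuclideanSpace ℝ (Fin 3)) : ℝ :=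
  ∏ k, inner ℝ ((Fin.cons a q : Fin (m + 1) → EuclideanSpace ℝ (Fin 3)) k)
    ((corrTensor (ρ k)).toEuclideanLin
      ((Fin.snoc p b : Fin (m + 1) → EuclideanSpace ℝ (Fin 3)) k))

section chain

variable (ρ : Fin (m + 1) → TwoQubitOp) (q p : Fin m → EuclideanSpace ℝ (Fin 3))
  (a a' b b' : EuclideanSpace ℝ (Fin 3)) (c : ℝ)

lemma chain_add_left : chain ρ q p (a + a') b = chain ρ q p a b + chain ρ q p a' b := by
  simp only [chain, Fin.prod_univ_succ, Fin.cons_zero, Fin.cons_succ, inner_add_left, add_mul]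

lemma chain_smul_left : chain ρ q p (c • a) b = c * chain ρ q p a b := by
  simp only [chain, Fin.prod_univ_succ, Fin.cons_zero, Fin.cons_succ, inner_smul_left, mul_assoc,
    conj_trivial]

lemma chain_add_right : chain ρ q p a (b + b') = chain ρ q p a b + chain ρ q p a b' := by
  simp only [chain, Fin.prod_univ_castSucc, Fin.snoc_last, Fin.snoc_castSucc, map_add,
    inner_add_right, mul_add]

lemma chain_smul_right : chain ρ q p a (c • b) = c * chain ρ q p a b := by
  simp only [chain, Fin.prod_univ_castSucc, Fin.snoc_last, Fin.snoc_castSucc, map_smul,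
    inner_smul_right, mul_left_comm]

lemma chain_neg_left : chain ρ q p (-a) b = -chain ρ q p a b := by
  rw [← neg_one_smul ℝ, chain_smul_left, neg_one_mul]

lemma chain_neg_right : chain ρ q p a (-b) = -chain ρ q p a b := by
  rw [← neg_one_smul ℝ, chain_smul_right, neg_one_mul]

end chain

lemma correlator_eq_chain {ρ : Fin (m + 1) → TwoQubitOp} (hρ : ∀ i, (ρ i).IsHermitian)
    (S : Settings m) (i : Fin 2) (q p : Fin m → EuclideanSpace ℝ (Fin 3))
    (hp : ∀ j, spinOp (p j) = (S.U j : QubitOp) * bellPauli i * (S.U j : QubitOp)ᴴ)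
    (hq : ∀ j, spinOp (q j) = (S.V j : QubitOp) * bellPauli i * (S.V j : QubitOp)ᴴ)
    (x y : Fin 2) : correlator ρ S i x y = chain ρ q p (S.a x) (S.b y) := by
  have h1 : (Fin.cons (spinOp (S.a x))
      (fun j => (S.V j : QubitOp) * bellPauli i * (S.V j : QubitOp)ᴴ) : Fin (m + 1) → QubitOp) =
      fun k => spinOp ((Fin.cons (S.a x) q : Fin (m + 1) → EuclideanSpace ℝ (Fin 3)) k) := by
    funext k
    refine Fin.cases ?_ (fun j => ?_) k <;> simp [hq]
  have h2 : (Fin.snoc (fun j => (S.U j : QubitOp) * bellPauli i * (S.U j : QubitOp)ᴴ)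
        (spinOp (S.b y)) : Fin (m + 1) → QubitOp) =
      fun k => spinOp ((Fin.snoc p (S.b y) : Fin (m + 1) → EuclideanSpace ℝ (Fin 3)) k) := by
    funext k
    refine Fin.lastCases ?_ (fun j => ?_) k <;> simp [hp]
  rw [correlator_eq, h1, h2]
  simp only [Matrix.trace_mul_comm _ (ρ _), trace_mul_kronecker_spinOp (hρ _)]
  rw [← Complex.ofReal_prod, Complex.ofReal_re, chain]

/-- `chain` is bilinear in the extreme settings, so averaging over the inputs averages the vectors.
-/
lemma termI_eq_chain {ρ : Fin (m + 1) → TwoQubitOp} (hρ : ∀ i, (ρ i).IsHermitian)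
    (S : Settings m) (q p : Fin m → EuclideanSpace ℝ (Fin 3))
    (hp : ∀ j, spinOp (p j) = (S.U j : QubitOp) * pauli 2 * (S.U j : QubitOp)ᴴ)
    (hq : ∀ j, spinOp (q j) = (S.V j : QubitOp) * pauli 2 * (S.V j : QubitOp)ᴴ) :
    termI ρ S = chain ρ q p ((1 / 2 : ℝ) • (S.a 0 + S.a 1)) ((1 / 2 : ℝ) • (S.b 0 + S.b 1)) := by
  simp only [termI, correlator_eq_chain hρ S 0 q p hp hq, Fin.sum_univ_two, chain_smul_left,
    chain_smul_right, chain_add_left, chain_add_right]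
  ring

lemma termJ_eq_chain {ρ : Fin (m + 1) → TwoQubitOp} (hρ : ∀ i, (ρ i).IsHermitian)
    (S : Settings m) (q p : Fin m → EuclideanSpace ℝ (Fin 3))
    (hp : ∀ j, spinOp (p j) = (S.U j : QubitOp) * pauli 0 * (S.U j : QubitOp)ᴴ)
    (hq : ∀ j, spinOp (q j) = (S.V j : QubitOp) * pauli 0 * (S.V j : QubitOp)ᴴ) :
    termJ ρ S = chain ρ q p ((1 / 2 : ℝ) • (S.a 0 - S.a 1)) ((1 / 2 : ℝ) • (S.b 0 - S.b 1)) := by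
  simp only [termJ, correlator_eq_chain hρ S 1 q p hp hq, Fin.sum_univ_two, chain_smul_left,
    chain_smul_right, chain_add_left, chain_add_right, sub_eq_add_neg, chain_neg_left,
    chain_neg_right]
  simp
  ring

/-! ### The maximum over all measurements -/

lemma exists_orthPair_of_norm_eq_one {x y : EuclideanSpace ℝ (Fin 3)} (hx : ‖x‖ = 1)
    (hy : ‖y‖ = 1) : ∃ (q q' : EuclideanSpace ℝ (Fin 3)) (c s : ℝ), OrthPair q q' ∧
      0 ≤ c ∧ 0 ≤ s ∧ c ^ 2 + s ^ 2 = 1 ∧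
      (1 / 2 : ℝ) • (x + y) = c • q ∧ (1 / 2 : ℝ) • (x - y) = s • q' := by
  have h0 : inner ℝ ((1 / 2 : ℝ) • (x + y)) ((1 / 2 : ℝ) • (x - y)) = 0 := by
    rw [inner_smul_left, inner_smul_right, real_inner_add_sub_eq_zero_iff _ _ |>.2 (hx.trans hy.symm)]
    simp
  obtain ⟨q, q', h, e, e'⟩ := exists_orthPair_of_inner_eq_zero (by simp) h0
  refine ⟨q, q', _, _, h, norm_nonneg _, norm_nonneg _, ?_, e, e'⟩
  have := parallelogram_law_with_norm ℝ x y
  rw [norm_smul, norm_smul, mul_pow, mul_pow]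
  norm_num
  rw [hx, hy] at this
  linarith

lemma sqrt_mul_add_sqrt_mul_le {α β X Y : ℝ} (hα : 0 ≤ α) (hβ : 0 ≤ β) (hX : 0 ≤ X) (hY : 0 ≤ Y)
    (h : α + β ≤ 1) : √(α * X) + √(β * Y) ≤ √(X + Y) := by
  refine Real.le_sqrt_of_sq_le ?_
  rw [Real.sqrt_mul hα, Real.sqrt_mul hβ]
  have h1 := Real.sq_sqrt hα
  have h2 := Real.sq_sqrt hβ
  have h3 := Real.sq_sqrt hX
  have h4 := Real.sq_sqrt hY
  have h5 : (√α * √X + √β * √Y) ^ 2 ≤ (√α ^ 2 + √β ^ 2) * (√X ^ 2 + √Y ^ 2) := by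
    nlinarith [sq_nonneg (√α * √Y - √β * √X)]
  rw [h1, h2, h3, h4] at h5
  nlinarith

/-- Equality in Cauchy-Schwarz: `(c, s)` is parallel to `(√P, √Q)`. -/
lemma exists_mul_sqrt_add_mul_sqrt_eq {P Q : ℝ} (hP : 0 ≤ P) (hQ : 0 ≤ Q) :
    ∃ c s : ℝ, 0 ≤ c ∧ 0 ≤ s ∧ c ^ 2 + s ^ 2 = 1 ∧ c * √P + s * √Q = √(P + Q) := by
  rcases (add_nonneg hP hQ).eq_or_lt' with h | h
  · have hP0 : P = 0 := by linarith
    have hQ0 : Q = 0 := by linarith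
    exact ⟨1, 0, by norm_num, le_rfl, by norm_num, by simp [hP0, hQ0]⟩
  · have hr : 0 < √(P + Q) := Real.sqrt_pos.2 h
    have hr2 := Real.sq_sqrt h.le
    have h1 := Real.sq_sqrt hP
    have h2 := Real.sq_sqrt hQ
    refine ⟨√P / √(P + Q), √Q / √(P + Q), by positivity, by positivity, ?_, ?_⟩
    · rw [div_pow, div_pow, h1, h2, hr2]
      field_simp
    · field_simp
      rw [h1, h2, hr2]

lemma orthPair_cons {q q' : Fin m → EuclideanSpace ℝ (Fin 3)} {a a' : EuclideanSpace ℝ (Fin 3)}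
    (ha : OrthPair a a') (h : ∀ j, OrthPair (q j) (q' j)) (k : Fin (m + 1)) :
    OrthPair ((Fin.cons a q : Fin (m + 1) → EuclideanSpace ℝ (Fin 3)) k)
      ((Fin.cons a' q' : Fin (m + 1) → EuclideanSpace ℝ (Fin 3)) k) := by
  refine Fin.cases ?_ (fun j => ?_) k <;> simp [*]

lemma orthPair_snoc {p p' : Fin m → EuclideanSpace ℝ (Fin 3)} {b b' : EuclideanSpace ℝ (Fin 3)}
    (hb : OrthPair b b') (h : ∀ j, OrthPair (p j) (p' j)) (k : Fin (m + 1)) :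
    OrthPair ((Fin.snoc p b : Fin (m + 1) → EuclideanSpace ℝ (Fin 3)) k)
      ((Fin.snoc p' b' : Fin (m + 1) → EuclideanSpace ℝ (Fin 3)) k) := by
  refine Fin.lastCases ?_ (fun j => ?_) k <;> simp [*]

lemma corrSing_nonneg (ρ : TwoQubitOp) (k : ℕ) : 0 ≤ corrSing ρ k :=
  LinearMap.singularValues_nonneg _ _

lemma corrSing_one_le_zero (ρ : TwoQubitOp) : corrSing ρ 1 ≤ corrSing ρ 0 :=
  LinearMap.singularValues_antitone _ (by norm_num)

lemma linearExpr_le_boundLinear {ρ : Fin (m + 1) → TwoQubitOp} (hρ : ∀ i, (ρ i).IsHermitian)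
    (S : Settings m) : linearExpr ρ S ≤ boundLinear ρ := by
  choose p p' hpp hp hp' using fun j => exists_spinOp_eq_conj (S.U j)
  choose q q' hqq hq hq' using fun j => exists_spinOp_eq_conj (S.V j)
  obtain ⟨a, a', c, s, haa, hc, hs, hcs, ha, ha'⟩ :=
    exists_orthPair_of_norm_eq_one (S.norm_a 0) (S.norm_a 1)
  obtain ⟨b, b', d, t, hbb, hd, ht, hdt, hb, hb'⟩ :=
    exists_orthPair_of_norm_eq_one (S.norm_b 0) (S.norm_b 1)
  have hmaj := prod_add_prod_le_of_weakMajorized Finset.univ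
    (fun k => |inner ℝ ((Fin.cons a q : Fin (m + 1) → EuclideanSpace ℝ (Fin 3)) k)
      ((corrTensor (ρ k)).toEuclideanLin
      ((Fin.snoc p b : Fin (m + 1) → EuclideanSpace ℝ (Fin 3)) k))|)
    (fun k => |inner ℝ ((Fin.cons a' q' : Fin (m + 1) → EuclideanSpace ℝ (Fin 3)) k)
      ((corrTensor (ρ k)).toEuclideanLin
      ((Fin.snoc p' b' : Fin (m + 1) → EuclideanSpace ℝ (Fin 3)) k))|)
    (fun k => corrSing (ρ k) 0) (fun k => corrSing (ρ k) 1)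
    (fun _ => abs_nonneg _) (fun _ => abs_nonneg _) (fun _ => corrSing_nonneg _ _)
    (fun _ => corrSing_one_le_zero _)
    (fun k => abs_inner_le_singularValue rfl _ _ _ (orthPair_cons haa hqq k).1
      (orthPair_snoc hbb hpp k).1)
    (fun k => abs_inner_le_singularValue rfl _ _ _ (orthPair_cons haa hqq k).2.1
      (orthPair_snoc hbb hpp k).2.1)
    (fun k => abs_inner_add_abs_inner_le (by simp) _ (orthPair_cons haa hqq k)
      (orthPair_snoc hbb hpp k))
  simp only [← Finset.abs_prod] at hmaj
  rw [linearExpr, termI_eq_chain hρ S q p hp hq, termJ_eq_chain hρ S q' p' hp' hq', ha, ha', hb,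
    hb', chain_smul_left, chain_smul_right, chain_smul_left, chain_smul_right, ← mul_assoc,
    ← mul_assoc, abs_mul (c * d), abs_mul (s * t), abs_of_nonneg (mul_nonneg hc hd),
    abs_of_nonneg (mul_nonneg hs ht)]
  refine (sqrt_mul_add_sqrt_mul_le (mul_nonneg hc hd) (mul_nonneg hs ht) (abs_nonneg _)
    (abs_nonneg _) ?_).trans (Real.sqrt_le_sqrt hmaj)
  -- AM-GM: `cd + st ≤ (c² + d² + s² + t²) / 2 = 1`.
  nlinarith [sq_nonneg (c - d), sq_nonneg (s - t)]

lemma exists_linearExpr_eq_boundLinear {ρ : Fin (m + 1) → TwoQubitOp}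
    (hρ : ∀ i, (ρ i).IsHermitian) : ∃ S : Settings m, linearExpr ρ S = boundLinear ρ := by
  choose q q' p p' hqq hpp h h' using fun k =>
    exists_orthPair_singular (by simp) ((corrTensor (ρ k)).toEuclideanLin)
  -- The right qubit of source `j` is measured along its right singular vectors, the left qubit of
  -- source `j + 1` along its left ones.
  choose U hU hU' using fun j : Fin m => exists_unitary_conj_eq_spinOp (hpp j.castSucc)
  choose V hV hV' using fun j : Fin m => exists_unitary_conj_eq_spinOp (hqq j.succ)
  obtain ⟨c, s, hc, hs, hcs, hmax⟩ := exists_mul_sqrt_add_mul_sqrt_eq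
    (Finset.prod_nonneg fun k (_ : k ∈ Finset.univ) => corrSing_nonneg (ρ k) 0)
    (Finset.prod_nonneg fun k (_ : k ∈ Finset.univ) => corrSing_nonneg (ρ k) 1)
  have hnorm {x y : EuclideanSpace ℝ (Fin 3)} (hxy : OrthPair x y) (z : Fin 2) :
      ‖(![c • x + s • y, c • x - s • y] : Fin 2 → EuclideanSpace ℝ (Fin 3)) z‖ = 1 := by
    have h0 : inner ℝ (c • x) (s • y) = 0 := by
      rw [inner_smul_left, inner_smul_right, hxy.2.2]; simp
    have h1 := norm_add_sq_real (c • x) (s • y)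
    have h2 := norm_sub_sq_real (c • x) (s • y)
    rw [h0, norm_smul, norm_smul, hxy.1, hxy.2.1] at h1 h2
    simp only [Real.norm_eq_abs, mul_one, sq_abs, mul_zero, add_zero, sub_zero, hcs] at h1 h2
    fin_cases z
    · exact (pow_eq_one_iff_of_nonneg (norm_nonneg _) two_ne_zero).1 h1
    · exact (pow_eq_one_iff_of_nonneg (norm_nonneg _) two_ne_zero).1 h2
  let S : Settings m :=
    { a := ![c • q 0 + s • q' 0, c • q 0 - s • q' 0]
      norm_a := hnorm (hqq 0)
      b := ![c • p (Fin.last m) + s • p' (Fin.last m), c • p (Fin.last m) - s • p' (Fin.last m)]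
      norm_b := hnorm (hpp _)
      U := U
      V := V }
  have hplus (x y : EuclideanSpace ℝ (Fin 3)) :
      (1 / 2 : ℝ) • ((c • x + s • y) + (c • x - s • y)) = c • x := by module
  have hminus (x y : EuclideanSpace ℝ (Fin 3)) :
      (1 / 2 : ℝ) • ((c • x + s • y) - (c • x - s • y)) = s • y := by module
  have hcons (r : Fin (m + 1) → EuclideanSpace ℝ (Fin 3)) :
      (Fin.cons (r 0) fun j : Fin m => r j.succ) = r := Fin.cons_self_tail r
  have hsnoc (r : Fin (m + 1) → EuclideanSpace ℝ (Fin 3)) :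
      (Fin.snoc (fun j : Fin m => r j.castSucc) (r (Fin.last m))) = r := Fin.snoc_init_self r
  have hI : termI ρ S = c * (c * ∏ k, corrSing (ρ k) 0) := by
    rw [termI_eq_chain hρ S (fun j => q j.succ) (fun j => p j.castSucc) hU hV]
    simp only [S, Matrix.cons_val_zero, Matrix.cons_val_one, hplus, chain_smul_left,
      chain_smul_right]
    simp only [chain, hcons, hsnoc, h]
    rfl
  have hJ : termJ ρ S = s * (s * ∏ k, corrSing (ρ k) 1) := by
    rw [termJ_eq_chain hρ S (fun j => q' j.succ) (fun j => p' j.castSucc) hU' hV']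
    simp only [S, Matrix.cons_val_zero, Matrix.cons_val_one, hminus, chain_smul_left,
      chain_smul_right]
    simp only [chain, hcons, hsnoc, h']
    rfl
  refine ⟨S, ?_⟩
  rw [linearExpr, hI, hJ, boundLinear, ← hmax, ← mul_assoc, ← mul_assoc, abs_mul (c * c),
    abs_mul (s * s),
    abs_mul_self, abs_mul_self, Real.sqrt_mul (mul_self_nonneg c),
    Real.sqrt_mul (mul_self_nonneg s), Real.sqrt_mul_self hc, Real.sqrt_mul_self hs,
    abs_of_nonneg (Finset.prod_nonneg fun k _ => corrSing_nonneg (ρ k) 0),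
    abs_of_nonneg (Finset.prod_nonneg fun k _ => corrSing_nonneg (ρ k) 1)]

/-! ### Autonne-Takagi factorization -/

section Takagi

variable {E : Type*} [NormedAddCommGroup E] [InnerProductSpace ℂ E] [FiniteDimensional ℂ E]

/-- A symmetric conjugate-linear map has an eigenvector with a real eigenvalue. -/
lemma exists_coneigenvector [Nontrivial E] (S : E →ₗ⋆[ℂ] E)
    (hS : ∀ x y, inner ℂ (S x) y = inner ℂ (S y) x) :
    ∃ x, ‖x‖ = 1 ∧ ∃ l : ℝ, S x = (l : ℂ) • x := by
  suffices h : ∃ x ≠ 0, ∃ l : ℝ, S x = (l : ℂ) • x by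
    obtain ⟨x, hx, l, hl⟩ := h
    refine ⟨((‖x‖⁻¹ : ℝ) : ℂ) • x, by simp [norm_smul, hx], l, ?_⟩
    rw [map_smulₛₗ, hl, Complex.conj_ofReal, smul_comm]
  -- `S ∘ S` is complex linear, and symmetry forces its eigenvalue to be `l²` with `l = ‖S v‖ /
  -- ‖v‖`. Then `S v + l v` has coneigenvalue `l`, unless it vanishes and `S v = -l v`.
  obtain ⟨μ, hμ⟩ := Module.End.exists_eigenvalue (S.comp S : Module.End ℂ E)
  obtain ⟨v, hv⟩ := hμ.exists_hasEigenvector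
  have hv0 : ‖v‖ ≠ 0 := norm_ne_zero_iff.2 hv.2
  have hSS : S (S v) = μ • v := hv.apply_eq_smul
  have h1 := hS (S v) v
  rw [hSS, inner_smul_left, inner_self_eq_norm_sq_to_K, inner_self_eq_norm_sq_to_K] at h1
  set l : ℝ := ‖S v‖ / ‖v‖ with hl
  have hμl : μ = (l : ℂ) * l := by
    have h2 : (starRingEnd ℂ) μ = ((l * l : ℝ) : ℂ) := by
      rw [hl]
      push_cast
      have : (‖v‖ : ℂ) ≠ 0 := by exact_mod_cast hv0
      field_simp
      exact h1
    have h3 := congrArg (starRingEnd ℂ) h2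
    rw [Complex.conj_conj, Complex.conj_ofReal] at h3
    rw [h3]; push_cast; rfl
  by_cases hx : S v + (l : ℂ) • v = 0
  · refine ⟨v, hv.2, -l, ?_⟩
    rw [eq_neg_of_add_eq_zero_left hx]
    simp
  · refine ⟨S v + (l : ℂ) • v, hx, l, ?_⟩
    rw [map_add, map_smulₛₗ, hSS, hμl, Complex.conj_ofReal]
    module

/-- Symmetry makes the orthogonal complement of coneigenvectors invariant, so another one can be
found there. -/
lemma exists_orthonormal_coneigenvectors (S : E →ₗ⋆[ℂ] E)
    (hS : ∀ x y, inner ℂ (S x) y = inner ℂ (S y) x) (j : ℕ) (hj : j ≤ Module.finrank ℂ E) :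
    ∃ v : Fin j → E, Orthonormal ℂ v ∧ ∃ l : Fin j → ℝ, ∀ i, S (v i) = (l i : ℂ) • v i := by
  induction j with
  | zero => exact ⟨Fin.elim0, ⟨fun i => i.elim0, fun i => i.elim0⟩, Fin.elim0, fun i => i.elim0⟩
  | succ j ih =>
    obtain ⟨v, hv, l, hl⟩ := ih (by omega)
    set K : Submodule ℂ E := (Submodule.span ℂ (Set.range v))ᗮ
    have hmem (x : E) : x ∈ K ↔ ∀ i, inner ℂ (v i) x = 0 := by
      rw [Submodule.mem_orthogonal]
      refine ⟨fun h i => h _ (Submodule.subset_span ⟨i, rfl⟩), fun h u hu => ?_⟩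
      induction hu using Submodule.span_induction with
      | mem u hu => obtain ⟨i, rfl⟩ := hu; exact h i
      | zero => simp
      | add a b _ _ ha hb => rw [inner_add_left, ha, hb, add_zero]
      | smul c a _ ha => rw [inner_smul_left, ha, mul_zero]
    have hK : K ≠ ⊥ := by
      intro h
      rw [Submodule.orthogonal_eq_bot_iff] at h
      have := finrank_range_le_card (R := ℂ) v
      rw [Set.finrank, h, finrank_top, Fintype.card_fin] at this
      omega
    have hSK (x : K) : S x ∈ K := by
      rw [hmem]
      intro i
      have h1 := hS x (v i)
      rw [hl, inner_smul_left, (hmem x).1 x.2 i, mul_zero] at h1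
      rw [← inner_conj_symm, h1, map_zero]
    have : Nontrivial K := Submodule.nontrivial_iff_ne_bot.2 hK
    obtain ⟨x, hx, c, hc⟩ := exists_coneigenvector ((S.domRestrict K).codRestrict K hSK)
      (fun x y => hS x y)
    have hc' : S x = (c : ℂ) • (x : E) := congrArg Subtype.val hc
    refine ⟨Matrix.vecCons (x : E) v, ?_, Matrix.vecCons c l, fun i => ?_⟩
    · rw [orthonormal_vecCons_iff]
      refine ⟨hx, fun i => ?_, hv⟩
      rw [← inner_conj_symm, (hmem x).1 x.2 i, map_zero]
    · refine Fin.cases ?_ (fun i => ?_) i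
      · simpa using hc'
      · simpa using hl i

/-- Autonne-Takagi factorization. -/
lemma exists_unitary_transpose_mul_mul_eq_diagonal {n : Type*} [Fintype n] [DecidableEq n]
    {τ : Matrix n n ℂ} (hτ : τᵀ = τ) :
    ∃ (W : Matrix n n ℂ) (d : n → ℂ), W * Wᴴ = 1 ∧ Wᵀ * τ * W = Matrix.diagonal d := by
  -- For `S x = conj (τ x)`, coneigenvectors as columns of `W` give `τ W = conj W * D` with `D`
  -- diagonal.
  let S : EuclideanSpace ℂ n →ₗ⋆[ℂ] EuclideanSpace ℂ n :=
    { toFun := fun x => WithLp.toLp 2 (star (τ *ᵥ x.ofLp))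
      map_add' := fun x y => by simp [Matrix.mulVec_add]
      map_smul' := fun c x => by simp [Matrix.mulVec_smul] }
  have hin (x y : EuclideanSpace ℂ n) : inner ℂ (S x) y = (τ *ᵥ x.ofLp) ⬝ᵥ y.ofLp := by
    simp [PiLp.inner_apply, S, dotProduct, mul_comm]
  obtain ⟨v, hv, l, hl⟩ := exists_orthonormal_coneigenvectors S (fun x y => by
    rw [hin, hin, dotProduct_comm, Matrix.dotProduct_mulVec, ← Matrix.mulVec_transpose, hτ])
    (Fintype.card n) (by simp)
  let e := Fintype.equivFin n
  let W : Matrix n n ℂ := Matrix.of fun a b => v (e b) a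
  have hW : Wᴴ * W = 1 := by
    ext a b
    have := (orthonormal_iff_ite.1 hv) (e a) (e b)
    rw [PiLp.inner_apply] at this
    simp only [Matrix.mul_apply, Matrix.conjTranspose_apply, W, Matrix.of_apply, Matrix.one_apply]
    simp only [EmbeddingLike.apply_eq_iff_eq] at this
    rw [← this]
    simp [mul_comm]
  refine ⟨W, fun b => l (e b), mul_eq_one_comm.1 hW, ?_⟩
  have hτW : τ * W = (Wᴴ)ᵀ * Matrix.diagonal (fun b => (l (e b) : ℂ)) := by
    ext a b
    have h1 := congrArg (fun x : EuclideanSpace ℂ n => star (x a)) (hl (e b))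
    simp only [S, LinearMap.coe_mk, AddHom.coe_mk, Pi.star_apply, PiLp.smul_apply,
      smul_eq_mul, star_mul', Complex.star_def, Complex.conj_ofReal, Complex.conj_conj] at h1
    rw [Matrix.mul_diagonal, Matrix.mul_apply]
    simp only [Matrix.transpose_apply, Matrix.conjTranspose_apply, W, Matrix.of_apply,
      Complex.star_def]
    rw [mul_comm, ← h1]
    rfl
  rw [mul_assoc, hτW, ← mul_assoc, ← Matrix.transpose_mul, hW, Matrix.transpose_one, one_mul]

end Takagi

/-! ### Closing a quadrilateral with phases -/

section Phases

/-- A triangle with sides `a`, `b`, `r` exists, by the intermediate value theorem in the angle. -/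
lemma exists_norm_add_mul_eq {a b r : ℝ} (h1 : |a - b| ≤ r) (h2 : r ≤ a + b) :
    ∃ z : ℂ, ‖z‖ = 1 ∧ ‖(a : ℂ) + z * b‖ = r := by
  have hcont : ContinuousOn (fun θ : ℝ => ‖(a : ℂ) + Complex.exp (θ * Complex.I) * b‖)
      (Set.Icc 0 Real.pi) := by fun_prop
  have h0 : 0 ≤ a + b := ((abs_nonneg _).trans h1).trans h2
  have hmem : r ∈ Set.Icc (‖(a : ℂ) + Complex.exp ((Real.pi : ℝ) * Complex.I) * b‖)
      (‖(a : ℂ) + Complex.exp ((0 : ℝ) * Complex.I) * b‖) := by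
    have e1 : (a : ℂ) + Complex.exp ((Real.pi : ℝ) * Complex.I) * b = ((a - b : ℝ) : ℂ) := by
      rw [Complex.exp_pi_mul_I]; push_cast; ring
    have e2 : (a : ℂ) + Complex.exp ((0 : ℝ) * Complex.I) * b = ((a + b : ℝ) : ℂ) := by
      simp
    rw [e1, e2, Complex.norm_real, Complex.norm_real, Real.norm_eq_abs, Real.norm_eq_abs,
      abs_of_nonneg h0]
    exact ⟨h1, h2⟩
  obtain ⟨θ, -, hθ⟩ := intermediate_value_Icc' Real.pi_pos.le hcont hmem
  exact ⟨_, Complex.norm_exp_ofReal_mul_I θ, hθ⟩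

lemma exists_phases_norm_sum_le {l : Fin 4 → ℝ} (hl : Antitone l) (h0 : ∀ k, 0 ≤ l k) :
    ∃ z : Fin 4 → ℂ, (∀ k, ‖z k‖ = 1) ∧
      ‖∑ k, z k * l k‖ ≤ max 0 (l 0 - l 1 - l 2 - l 3) := by
  have h01 : l 1 ≤ l 0 := hl (by decide)
  have h12 : l 2 ≤ l 1 := hl (by decide)
  have h23 : l 3 ≤ l 2 := hl (by decide)
  have h3 := h0 3
  rcases le_total 0 (l 0 - l 1 - l 2 - l 3) with h | h
  · refine ⟨![1, -1, -1, -1], fun k => by fin_cases k <;> simp, ?_⟩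
    rw [max_eq_right h, Fin.sum_univ_four]
    have : (![1, -1, -1, -1] : Fin 4 → ℂ) 0 * l 0 + (![1, -1, -1, -1] : Fin 4 → ℂ) 1 * l 1 +
        (![1, -1, -1, -1] : Fin 4 → ℂ) 2 * l 2 + (![1, -1, -1, -1] : Fin 4 → ℂ) 3 * l 3 =
        ((l 0 - l 1 - l 2 - l 3 : ℝ) : ℂ) := by
      simp; ring
    rw [this, Complex.norm_real, Real.norm_of_nonneg h]
  -- No side exceeds the sum of the others, so the quadrilateral closes; `r` is a diagonal length
  -- admissible for both triangles.
  · obtain ⟨z, hz, hz'⟩ := exists_norm_add_mul_eq (a := l 0) (b := l 1)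
      (r := max (l 0 - l 1) (l 2 - l 3)) (by rw [abs_of_nonneg (by linarith)]; exact le_max_left _ _)
      (max_le (by linarith) (by linarith))
    obtain ⟨w, hw, hw'⟩ := exists_norm_add_mul_eq (a := l 2) (b := l 3)
      (r := max (l 0 - l 1) (l 2 - l 3)) (by rw [abs_of_nonneg (by linarith)]; exact le_max_right _ _)
      (max_le (by linarith) (by linarith))
    obtain ⟨u, hu, hu'⟩ : ∃ u : ℂ, ‖u‖ = 1 ∧ (l 0 : ℂ) + z * l 1 + u * (l 2 + w * l 3) = 0 := by
      by_cases hb : (l 2 : ℂ) + w * l 3 = 0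
      · refine ⟨1, by simp, ?_⟩
        rw [hb, norm_zero] at hw'
        rw [← hw', norm_eq_zero] at hz'
        rw [hz', hb]; simp
      · refine ⟨-((l 0 : ℂ) + z * l 1) / (l 2 + w * l 3), ?_, ?_⟩
        · rw [norm_div, norm_neg, hz', ← hw', div_self (norm_ne_zero_iff.2 hb)]
        · field_simp
          ring
    refine ⟨![1, z, u, u * w], fun k => by fin_cases k <;> simp [hz, hu, hw], ?_⟩
    refine le_trans (le_of_eq ?_) (le_max_left _ _)
    rw [norm_eq_zero, Fin.sum_univ_four, ← hu']
    simp
    ring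

lemma exists_phase_sq_mul_eq (z d : ℂ) (hz : ‖z‖ = 1) :
    ∃ w : ℂ, ‖w‖ = 1 ∧ w ^ 2 * d = z * ‖d‖ := by
  by_cases hd : d = 0
  · exact ⟨1, by simp, by simp [hd]⟩
  · obtain ⟨w, hw⟩ := IsAlgClosed.exists_pow_nat_eq (z * ‖d‖ / d) (n := 2) (by norm_num)
    refine ⟨w, ?_, by rw [hw]; field_simp⟩
    have : ‖w‖ ^ 2 = 1 := by
      rw [← norm_pow, hw, norm_div, norm_mul, hz, Complex.norm_real, norm_norm, one_mul,
        div_self (norm_ne_zero_iff.2 hd)]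
    exact (pow_eq_one_iff_of_nonneg (norm_nonneg _) two_ne_zero).1 this

end Phases

/-! ### Wootters' optimal decomposition -/

section Concurrence

/-- The matrix `σ₂ ⊗ σ₂` of the spin flip. -/
abbrev spinFlip : TwoQubitOp := pauli 1 ⊗ₖ pauli 1

lemma spinFlip_transpose : spinFlipᵀ = spinFlip := by
  ext ⟨a, b⟩ ⟨c, d⟩
  fin_cases a <;> fin_cases b <;> fin_cases c <;> fin_cases d <;> simp [pauli]

lemma spinFlip_conjTranspose : spinFlipᴴ = spinFlip := by
  rw [Matrix.conjTranspose_kronecker, (pauli_isHermitian 1).eq]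

open scoped MatrixOrder Matrix.Norms.L2Operator in
lemma exists_conjTranspose_mul_self_eq {n : Type*} [Fintype n] [DecidableEq n] {M : Matrix n n ℂ}
    (hM : M.PosSemidef) : ∃ B : Matrix n n ℂ, M = Bᴴ * B :=
  CStarAlgebra.nonneg_iff_eq_star_mul_self.1 hM.nonneg

/-- A factor of `ρ` is free up to a unitary on the right, which acts on its symmetric spin-flip form
by congruence; Takagi diagonalizes that form. -/
lemma exists_factor_transpose_spinFlip_diagonal {ρ : TwoQubitOp} (hρ : ρ.PosSemidef) :
    ∃ (A : TwoQubitOp) (d : Fin 2 × Fin 2 → ℂ), A * Aᴴ = ρ ∧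
      Aᵀ * spinFlip * A = Matrix.diagonal d := by
  obtain ⟨B, hB⟩ := exists_conjTranspose_mul_self_eq hρ
  obtain ⟨W, d, hW, hd⟩ := exists_unitary_transpose_mul_mul_eq_diagonal
    (τ := (Bᴴ)ᵀ * spinFlip * Bᴴ) (by
      rw [Matrix.transpose_mul, Matrix.transpose_mul, spinFlip_transpose, Matrix.transpose_transpose,
        mul_assoc])
  refine ⟨Bᴴ * W, d, ?_, ?_⟩
  · rw [Matrix.conjTranspose_mul, Matrix.conjTranspose_conjTranspose, mul_assoc, ← mul_assoc W, hW,
      one_mul, hB]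
  · rw [← hd, Matrix.transpose_mul]
    simp only [mul_assoc]

/-- Moving `A` cyclically inside the characteristic polynomial leaves `conj D * D` with `D = Aᵀ *
spinFlip * A`. -/
lemma charpoly_woottersMatrix {ρ A : TwoQubitOp} {d : Fin 2 × Fin 2 → ℂ} (hA : A * Aᴴ = ρ)
    (hd : Aᵀ * spinFlip * A = Matrix.diagonal d) :
    (woottersMatrix ρ).charpoly = (Matrix.diagonal fun i => ((‖d i‖ ^ 2 : ℝ) : ℂ)).charpoly := by
  have h1 : Aᴴ * spinFlip * (Aᴴ)ᵀ = Matrix.diagonal (star d) := by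
    rw [← Matrix.diagonal_conjTranspose, ← hd, Matrix.conjTranspose_mul, Matrix.conjTranspose_mul,
      spinFlip_conjTranspose, mul_assoc]
    rfl
  have h2 : woottersMatrix ρ = A * (Aᴴ * spinFlip * (Aᴴ)ᵀ * (Aᵀ * spinFlip)) := by
    rw [woottersMatrix, ← hA, Matrix.transpose_mul]
    simp only [mul_assoc]
  rw [h2, Matrix.charpoly_mul_comm, mul_assoc, hd, h1, Matrix.diagonal_mul_diagonal]
  congr 2
  funext i
  rw [Pi.star_apply, Complex.star_def, Complex.conj_mul']
  push_cast
  rfl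

lemma concurrence_eq {ρ A : TwoQubitOp} {d : Fin 2 × Fin 2 → ℂ} (hA : A * Aᴴ = ρ)
    (hd : Aᵀ * spinFlip * A = Matrix.diagonal d) (e : Fin 4 ≃ Fin 2 × Fin 2)
    (he : Antitone fun k => ‖d (e k)‖) :
    concurrence ρ = max 0 (‖d (e 0)‖ - ‖d (e 1)‖ - ‖d (e 2)‖ - ‖d (e 3)‖) := by
  have hroots : (woottersMatrix ρ).charpoly.roots =
      Finset.univ.val.map fun i => ((‖d i‖ ^ 2 : ℝ) : ℂ) := by
    rw [charpoly_woottersMatrix hA hd, Matrix.charpoly_diagonal]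
    exact Polynomial.roots_multiset_prod_X_sub_C
      (Finset.univ.val.map fun i => ((‖d i‖ ^ 2 : ℝ) : ℂ)) ▸ by
        rw [Multiset.map_map]; rfl
  have hms : ((woottersMatrix ρ).charpoly.roots.map fun z : ℂ => √z.re) =
      (List.ofFn fun k => ‖d (e k)‖ : Multiset ℝ) := by
    rw [hroots, Multiset.map_map]
    have h1 : (Finset.univ : Finset (Fin 2 × Fin 2)) = Finset.univ.map e.toEmbedding := by simp
    rw [h1, Finset.map_val, Multiset.map_map, List.ofFn_eq_map]
    simp only [Function.comp_def, Complex.ofReal_re, Real.sqrt_sq (norm_nonneg _)]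
    rfl
  have hlist : woottersList ρ = List.ofFn fun k => ‖d (e k)‖ := by
    rw [woottersList, hms]
    refine List.Perm.eq_of_pairwise' (r := (· ≥ ·)) (Multiset.pairwise_sort _ _) ?_
      (Multiset.coe_eq_coe.1 (Multiset.sort_eq _ _))
    rw [List.pairwise_ofFn]
    exact fun i j hij => he hij.le
  rw [concurrence, hlist]
  simp [List.ofFn_succ]

/-- The unitary Hadamard matrix on two qubits. -/
def hadamard : TwoQubitOp :=
  Matrix.of fun s t => (1 / 2 : ℂ) * (-1) ^ ((s.1 * t.1 : ℕ) + (s.2 * t.2 : ℕ))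

lemma hadamard_mul_conjTranspose : hadamard * hadamardᴴ = 1 := by
  ext ⟨a, b⟩ ⟨c, d⟩
  rw [Matrix.mul_apply, Fintype.sum_prod_type]
  fin_cases a <;> fin_cases b <;> fin_cases c <;> fin_cases d <;>
    norm_num [hadamard, Matrix.one_apply]

/-- Congruence by `hadamard` thus makes all diagonal entries of a diagonal form equal to a quarter
of its trace. -/
lemma hadamard_sq (s t : Fin 2 × Fin 2) : hadamard s t * hadamard s t = 1 / 4 := by
  rw [hadamard, Matrix.of_apply, mul_mul_mul_comm, ← mul_pow]
  norm_num

/-- A decomposition of a state into pure ones whose average concurrence is the one of the state. -/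
lemma exists_factor_sum_norm_le_concurrence {ρ : TwoQubitOp} (hρ : ρ.PosSemidef) :
    ∃ B : TwoQubitOp, B * Bᴴ = ρ ∧
      ∑ j, ‖(Bᵀ * spinFlip * B) j j‖ ≤ concurrence ρ := by
  obtain ⟨A, d, hA, hd⟩ := exists_factor_transpose_spinFlip_diagonal hρ
  obtain ⟨e, he⟩ : ∃ e : Fin 4 ≃ Fin 2 × Fin 2, Antitone fun k => ‖d (e k)‖ := by
    let e₀ : Fin 4 ≃ Fin 2 × Fin 2 := (finProdFinEquiv (m := 2) (n := 2)).symm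
    refine ⟨(Tuple.sort fun k => -‖d (e₀ k)‖).trans e₀, fun i j hij => ?_⟩
    exact neg_le_neg_iff.1 (Tuple.monotone_sort (fun k => -‖d (e₀ k)‖) hij)
  obtain ⟨z, hz, hzle⟩ := exists_phases_norm_sum_le he fun k => norm_nonneg _
  choose w hw hwd using fun i => exists_phase_sq_mul_eq (z (e.symm i)) (d i) (hz _)
  have hD : Matrix.diagonal w * (Matrix.diagonal w)ᴴ = 1 := by
    rw [Matrix.diagonal_conjTranspose, Matrix.diagonal_mul_diagonal, ← Matrix.diagonal_one]
    congr 1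
    funext i
    rw [Pi.star_apply, Complex.star_def, Complex.mul_conj', hw]
    simp
  -- The phases `w` turn the form into `z k * ‖d (e k)‖`; each of the four columns then carries a
  -- quarter of the minimized sum.
  refine ⟨A * Matrix.diagonal w * hadamard, ?_, ?_⟩
  · rw [Matrix.conjTranspose_mul, mul_assoc, ← mul_assoc hadamard, hadamard_mul_conjTranspose,
      one_mul, Matrix.conjTranspose_mul, mul_assoc, ← mul_assoc (Matrix.diagonal w), hD, one_mul, hA]
  · have h1 : (A * Matrix.diagonal w * hadamard)ᵀ * spinFlip * (A * Matrix.diagonal w * hadamard) =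
        hadamardᵀ * Matrix.diagonal (fun i => w i ^ 2 * d i) * hadamard := by
      have h2 : Matrix.diagonal (fun i => w i ^ 2 * d i) =
          Matrix.diagonal w * (Aᵀ * spinFlip * A) * Matrix.diagonal w := by
        rw [hd, Matrix.diagonal_mul_diagonal, Matrix.diagonal_mul_diagonal]
        congr 1
        funext i
        ring
      rw [h2, Matrix.transpose_mul, Matrix.transpose_mul, Matrix.diagonal_transpose]
      simp only [mul_assoc]
    have h3 (j) : (hadamardᵀ * Matrix.diagonal (fun i => w i ^ 2 * d i) * hadamard) j j =
        1 / 4 * ∑ k, z k * ‖d (e k)‖ := by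
      rw [Matrix.mul_apply, Finset.mul_sum, ← e.symm.sum_comp]
      refine Finset.sum_congr rfl fun i _ => ?_
      rw [Matrix.mul_diagonal, Matrix.transpose_apply, mul_right_comm, hadamard_sq, hwd,
        Equiv.apply_symm_apply]
    rw [h1]
    simp only [h3, norm_mul, Finset.sum_const, Finset.card_univ, Fintype.card_prod,
      Fintype.card_fin]
    rw [concurrence_eq hA hd e he]
    refine le_trans (le_of_eq ?_) hzle
    norm_num
    ring

end Concurrence

/-! ### Correlations against concurrence -/

section PureBound

/-- For the vector `(a, b, c, d)` the left side is `⟨σ₁ ⊗ σ₁⟩`, and `2‖b‖² + 2‖c‖²` is the squared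
norm minus `⟨σ₃ ⊗ σ₃⟩`. -/
lemma pauli_expectation_le (a b c d : ℂ) :
    2 * (star a * d).re + 2 * (star b * c).re ≤
      2 * ‖b‖ ^ 2 + 2 * ‖c‖ ^ 2 + ‖2 * (b * c) - 2 * (a * d)‖ := by
  have h1 : (star a * d).re ≤ ‖a * d‖ := by
    refine (Complex.re_le_norm _).trans (le_of_eq ?_); simp
  have h2 : (star b * c).re ≤ ‖b‖ * ‖c‖ := by
    refine (Complex.re_le_norm _).trans (le_of_eq ?_); simp
  have h3 : ‖2 * (a * d)‖ ≤ ‖2 * (b * c)‖ + ‖2 * (b * c) - 2 * (a * d)‖ := by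
    have := norm_sub_le (2 * (b * c)) (2 * (b * c) - 2 * (a * d))
    rwa [sub_sub_cancel] at this
  have h4 : ‖2 * (a * d)‖ = 2 * ‖a * d‖ := by simp
  have h5 : ‖2 * (b * c)‖ = 2 * (‖b‖ * ‖c‖) := by simp
  nlinarith [sq_nonneg (‖b‖ - ‖c‖)]

lemma re_trace_factor_mul_pauli_two_le (B : TwoQubitOp) :
    (B * Bᴴ * (pauli 2 ⊗ₖ pauli 2)).trace.re ≤ (B * Bᴴ).trace.re := by
  rw [mul_assoc, Matrix.trace_mul_comm, Matrix.trace_mul_comm B]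
  simp only [Matrix.trace, Complex.re_sum, Matrix.diag_apply]
  refine Finset.sum_le_sum fun j _ => ?_
  simp only [Matrix.mul_apply, Fintype.sum_prod_type, Fin.sum_univ_two, pauli]
  simp
  nlinarith [sq_nonneg (B (0, 1) j).re, sq_nonneg (B (0, 1) j).im, sq_nonneg (B (1, 0) j).re,
    sq_nonneg (B (1, 0) j).im]

lemma re_trace_factor_mul_pauli_add_le (B : TwoQubitOp) :
    (B * Bᴴ * (pauli 2 ⊗ₖ pauli 2)).trace.re + (B * Bᴴ * (pauli 0 ⊗ₖ pauli 0)).trace.re ≤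
      (B * Bᴴ).trace.re + ∑ j, ‖(Bᵀ * spinFlip * B) j j‖ := by
  rw [mul_assoc, Matrix.trace_mul_comm, mul_assoc B, Matrix.trace_mul_comm B,
    Matrix.trace_mul_comm B]
  simp only [Matrix.trace, Complex.re_sum, Matrix.diag_apply, ← Finset.sum_add_distrib]
  refine Finset.sum_le_sum fun j _ => ?_
  have h1 : (Bᵀ * spinFlip * B) j j =
      2 * (B (0, 1) j * B (1, 0) j) - 2 * (B (0, 0) j * B (1, 1) j) := by
    simp only [Matrix.mul_apply, Fintype.sum_prod_type, Fin.sum_univ_two, spinFlip, pauli]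
    simp
    ring
  have h2 := pauli_expectation_le (B (0, 0) j) (B (0, 1) j) (B (1, 0) j) (B (1, 1) j)
  rw [h1]
  simp only [Matrix.mul_apply, Fintype.sum_prod_type, Fin.sum_univ_two, pauli]
  rw [← Complex.normSq_eq_norm_sq, ← Complex.normSq_eq_norm_sq, Complex.normSq_apply,
    Complex.normSq_apply] at h2
  simp at h2 ⊢
  linarith

/-- `σ₂` is a multiple of the alternating form, which scales by the determinant. -/
lemma transpose_mul_pauli_one_mul (U : QubitOp) : Uᵀ * pauli 1 * U = U.det • pauli 1 := by
  ext i j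
  fin_cases i <;> fin_cases j <;>
    simp [Matrix.mul_apply, Fin.sum_univ_two, pauli, Matrix.det_fin_two] <;> ring

lemma norm_det_conjTranspose_unitary (U : Matrix.unitaryGroup (Fin 2) ℂ) :
    ‖((U : QubitOp)ᴴ).det‖ = 1 := by
  have h : (U : QubitOp)ᴴ * (U : QubitOp) = 1 := Matrix.UnitaryGroup.star_mul_self U
  have h1 := congrArg (fun M => ‖M.det‖) h
  simp only [Matrix.det_mul, norm_mul, Matrix.det_one, norm_one, Matrix.det_conjTranspose,
    norm_star] at h1 ⊢
  nlinarith [norm_nonneg (U : QubitOp).det]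

variable {ρ : TwoQubitOp}

/-- The spin-flip form of a factor is preserved in modulus by local unitaries. -/
lemma exists_factor_local_unitary (U V : Matrix.unitaryGroup (Fin 2) ℂ) (B : TwoQubitOp) :
    ∃ B' : TwoQubitOp, (B' * B'ᴴ).trace = (B * Bᴴ).trace ∧
      (∀ j, ‖(B'ᵀ * spinFlip * B') j j‖ = ‖(Bᵀ * spinFlip * B) j j‖) ∧
      ∀ k, (B' * B'ᴴ * (pauli k ⊗ₖ pauli k)).trace =
        (B * Bᴴ * (((U : QubitOp) * pauli k * (U : QubitOp)ᴴ) ⊗ₖ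
          ((V : QubitOp) * pauli k * (V : QubitOp)ᴴ))).trace := by
  have hU : (U : QubitOp) * (U : QubitOp)ᴴ = 1 := Matrix.mem_unitaryGroup_iff.1 U.2
  have hV : (V : QubitOp) * (V : QubitOp)ᴴ = 1 := Matrix.mem_unitaryGroup_iff.1 V.2
  set G : TwoQubitOp := (U : QubitOp) ⊗ₖ (V : QubitOp) with hG
  have hGG : G * Gᴴ = 1 := by
    rw [hG, Matrix.conjTranspose_kronecker, ← Matrix.mul_kronecker_mul, hU, hV,
      Matrix.one_kronecker_one]
  have hY : (Gᴴ)ᵀ * spinFlip * Gᴴ =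
      (((U : QubitOp)ᴴ).det * ((V : QubitOp)ᴴ).det) • spinFlip := by
    rw [hG, Matrix.conjTranspose_kronecker, ← Matrix.kroneckerMap_transpose, spinFlip,
      ← Matrix.mul_kronecker_mul, ← Matrix.mul_kronecker_mul, transpose_mul_pauli_one_mul,
      transpose_mul_pauli_one_mul, Matrix.smul_kronecker, Matrix.kronecker_smul, smul_smul]
  have hBB : Gᴴ * B * (Gᴴ * B)ᴴ = Gᴴ * (B * Bᴴ) * G := by
    rw [Matrix.conjTranspose_mul, Matrix.conjTranspose_conjTranspose]
    simp only [mul_assoc]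
  refine ⟨Gᴴ * B, ?_, fun j => ?_, fun k => ?_⟩
  · rw [hBB, Matrix.trace_mul_comm, ← mul_assoc, hGG, one_mul]
  · have : (Gᴴ * B)ᵀ * spinFlip * (Gᴴ * B) = Bᵀ * ((Gᴴ)ᵀ * spinFlip * Gᴴ) * B := by
      rw [Matrix.transpose_mul]
      simp only [mul_assoc]
    rw [this, hY, Matrix.mul_smul, Matrix.smul_mul, Matrix.smul_apply, norm_smul, norm_mul,
      norm_det_conjTranspose_unitary, norm_det_conjTranspose_unitary, one_mul, one_mul]
  · rw [Matrix.mul_kronecker_mul, Matrix.mul_kronecker_mul, ← hG, ← Matrix.conjTranspose_kronecker,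
      ← hG, hBB]
    rw [show Gᴴ * (B * Bᴴ) * G * (pauli k ⊗ₖ pauli k) =
      Gᴴ * ((B * Bᴴ) * (G * (pauli k ⊗ₖ pauli k))) by simp only [mul_assoc],
      Matrix.trace_mul_comm]
    simp only [mul_assoc]

lemma corrSing_bounds (hρ : IsState ρ) :
    corrSing ρ 0 ≤ 1 ∧ corrSing ρ 0 + corrSing ρ 1 ≤ 1 + concurrence ρ := by
  obtain ⟨q, q', p, p', hq, hp, h0, h1⟩ :=
    exists_orthPair_singular (by simp) ((corrTensor ρ).toEuclideanLin)
  obtain ⟨U, hU, hU'⟩ := exists_unitary_conj_eq_spinOp hq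
  obtain ⟨V, hV, hV'⟩ := exists_unitary_conj_eq_spinOp hp
  obtain ⟨B, hB, hC⟩ := exists_factor_sum_norm_le_concurrence hρ.1
  obtain ⟨B', htr, hdet, hk⟩ := exists_factor_local_unitary U V B
  have e0 : corrSing ρ 0 = (B' * B'ᴴ * (pauli 2 ⊗ₖ pauli 2)).trace.re := by
    rw [hk, hB, ← hU, ← hV, trace_mul_kronecker_spinOp hρ.1.1, Complex.ofReal_re, h0]
    rfl
  have e1 : corrSing ρ 1 = (B' * B'ᴴ * (pauli 0 ⊗ₖ pauli 0)).trace.re := by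
    rw [hk, hB, ← hU', ← hV', trace_mul_kronecker_spinOp hρ.1.1, Complex.ofReal_re, h1]
    rfl
  have htr1 : (B' * B'ᴴ).trace.re = 1 := by rw [htr, hB, hρ.2, Complex.one_re]
  refine ⟨?_, ?_⟩
  · rw [e0, ← htr1]
    exact re_trace_factor_mul_pauli_two_le B'
  · rw [e0, e1, ← htr1]
    refine (re_trace_factor_mul_pauli_add_le B').trans ?_
    simp only [hdet]
    linarith

end PureBound

lemma boundLinear_le {m : ℕ} {ρ : Fin (m + 1) → TwoQubitOp} (hρ : ∀ i, IsState (ρ i)) :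
    boundLinear ρ ≤ √(1 + ∏ i, concurrence (ρ i)) := by
  refine Real.sqrt_le_sqrt ?_
  have hC (i) : 0 ≤ concurrence (ρ i) := le_max_left _ _
  have h1 (i) := (corrSing_bounds (hρ i)).1
  have h2 (i) := (corrSing_bounds (hρ i)).2
  have hle (i) := corrSing_one_le_zero (ρ i)
  -- The truncation `min 1 C` ensures the ordering `f ≤ e` without a proof that the concurrence is
  -- at most 1.
  refine (prod_add_prod_le_of_weakMajorized Finset.univ _ _ (fun _ => 1)
    (fun i => min 1 (concurrence (ρ i))) (fun i => corrSing_nonneg (ρ i) 0)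
    (fun i => corrSing_nonneg (ρ i) 1) (fun i => le_min zero_le_one (hC i))
    (fun i => min_le_left _ _) h1 (fun i => (hle i).trans (h1 i)) fun i => ?_).trans ?_
  · rcases min_cases 1 (concurrence (ρ i)) with h | h
    · rw [h.1]; linarith [h1 i, hle i]
    · rw [h.1]; exact h2 i
  · rw [Finset.prod_const_one]
    exact add_le_add_right (Finset.prod_le_prod (fun i _ => le_min zero_le_one (hC i))
      fun i _ => min_le_right _ _) 1

end QNetwork

end

theorem theorem1 (m : ℕ) (ρ : Fin (m + 1) → QNetwork.TwoQubitOp)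
    (hρ : ∀ i, QNetwork.IsState (ρ i)) :
    IsGreatest (Set.range fun S : QNetwork.Settings m => QNetwork.linearExpr ρ S)
        (QNetwork.boundLinear ρ) ∧
      QNetwork.boundLinear ρ ≤ √(1 + ∏ i, QNetwork.concurrence (ρ i)) := by
  refine ⟨⟨QNetwork.exists_linearExpr_eq_boundLinear fun i => (hρ i).1.1, ?_⟩,
    QNetwork.boundLinear_le hρ⟩
  rintro _ ⟨S, rfl⟩
  exact QNetwork.linearExpr_le_boundLinear (fun i => (hρ i).1.1) S
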